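/- All groups are finite and $p$ is a prime. For subgroups $A,B$ of a group, say that $A$ and $B$ permute if $AB=BA$. A subgroup $A$ of a group $X$ is $s$-permutable in $X$ if $A$ permutes with every Sylow subgroup of $X$, and $s$-semipermutable in $X$ if $A$ permutes with every Sylow $q$-subgroup of $X$ for every prime $q$ not dividing $|A|$. A group is $p$-solvable if each of its chief factors is a $p$-group or a $p'$-group, and $p$-supersolvable if each of its chief factors has order $p$ or is a $p'$-group. Theorem. Let $G$ be a $p$-solvable group, and let $P$ be a Sylow $p$-subgroup of $G$. Assume that there is a subgroup $H$ of $P$ such that $P' \le H \le \Phi(P)$ and such that $H$ is $s$-semipermutable in $G$, where $P'$ is the derived subgroup and $\Phi(P)$ the Frattini subgroup of $P$. Suppose that $P$ has a subgroup $D$ with $1 < |D| < |P|$ such that any subgroup of $P$ with order $|D|$ is $s$-permutable in $N_G(P)$. If $P$ is a nonabelian $2$-group and $|D| = 2$, suppose moreover that any cyclic subgroup of $P$ with order $4$ is $s$-permutable in $N_G(P)$. Then $G$ is $p$-supersolvable. -/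

import Mathlib

open scoped Pointwise

/-- Two subgroups `H` and `K` permute if `HK = KH` as sets. -/
def SubgroupsPermute {G : Type*} [Group G] (H K : Subgroup G) : Prop :=
  (H : Set G) * (K : Set G) = (K : Set G) * (H : Set G)

/-- `H` is `s`-permutable in `G` if it permutes with every Sylow subgroup of `G`
(for every prime). -/
def IsSPermutable {G : Type*} [Group G] (H : Subgroup G) : Prop :=
  ∀ q : ℕ, q.Prime → ∀ Q : Sylow q G, SubgroupsPermute H (Q : Subgroup G)

/-- `H` is `s`-semipermutable in `G` if it permutes with every Sylow `q`-subgroup of `G`,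
for all primes `q` not dividing `|H|`. -/
def IsSSemipermutable {G : Type*} [Group G] (H : Subgroup G) : Prop :=
  ∀ q : ℕ, q.Prime → ¬ q ∣ Nat.card H →
    ∀ Q : Sylow q G, SubgroupsPermute H (Q : Subgroup G)

/-- `N / M` is a chief factor of `G`: `M < N` are normal subgroups of `G`, and no normal subgroup
of `G` lies strictly between them. Its order is `M.relIndex N`. -/
structure IsChiefFactor {G : Type*} [Group G] (M N : Subgroup G) : Prop where
  normal_bot : M.Normal
  normal_top : N.Normal
  lt : M < N
  eq_or_eq : ∀ L : Subgroup G, L.Normal → M ≤ L → L ≤ N → L = M ∨ L = N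

/-- A finite group is `p`-solvable if each of its chief factors is a `p`-group or a `p'`-group. -/
def IsPSolvable (p : ℕ) (G : Type*) [Group G] : Prop :=
  ∀ M N : Subgroup G, IsChiefFactor M N →
    (∃ n : ℕ, M.relIndex N = p ^ n) ∨ ¬ p ∣ M.relIndex N

/-- A finite group is `p`-supersolvable if each of its chief factors has order `p` or is a
`p'`-group. -/
def IsPSupersolvable (p : ℕ) (G : Type*) [Group G] : Prop :=
  ∀ M N : Subgroup G, IsChiefFactor M N →
    M.relIndex N = p ∨ ¬ p ∣ M.relIndex N

/-!
Let `K` be the largest normal `p'`-subgroup of `G`. The proof shows that `KP` is normal, so that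
`G = K N_G(P)`, and that the `p'`-elements of `N_G(P)` act on `P` like an abelian group of exponent
dividing `p - 1`. Then every chief factor of `p`-power order is an irreducible module over the field
with `p` elements on which `G` acts through such an abelian group, hence it has order `p`
(`card_eq_prime_of_minimal_normal`).

*Normality of `KP`* (`IsPermutableNongenerator.exists_normal_sup_normal`). Induction on `|G|` reduces
to `K = 1`. Put `U = O_p(G)`, the normal core of `P`, and `L = H ∩ U`. For a Sylow `q`-subgroup `S`
with `q ≠ p`, the product `HS` is a subgroup and `HS ∩ U = L`, so `S` normalizes `L`; so does `P`,
because `P' ≤ H`. Thus `L` is normal in `G`. If `L = 1`, then `[P, U] ≤ P' ∩ U ≤ L = 1`, and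
`C_G(U) ≤ U` gives `P = U`. If `L ≠ 1`, induction applies to `G / Z(L)`: it gives a normal subgroup
`Z(L)T`, with `T` a `p'`-group, whose product with `P` is normal. The complements of `Z(L)` are
conjugate, so `G = Z(L) N_G(T)`; as `Z(L) ≤ Φ(P)`, the subgroup `P` normalizes `T`. So `T` is normal
in `G`, hence trivial, and `P` is normal.

*Action of `N_G(P)` on `P`* (`mem_centralizer_of_forall_card_eq`). A complement `Q` of `P` in
`N_G(P)` normalizes every subgroup of `P` of order `d = |D|`. An element `k` of the form `a ^ (p - 1)`
or `⁅a, b⁆` with `a, b ∈ Q` acts trivially on each `Q`-invariant section of order `p`, so it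
centralizes every `Q`-invariant subgroup all of whose maximal subgroups are `Q`-invariant
(`mem_centralizer_of_forall_covBy`). If `k` does not centralize `P`, take `R ≤ P` minimal among the
`k`-invariant subgroups that `k` does not centralize. Then `R` has exponent `p`, or at most `4` if `P`
is a nonabelian `2`-group (`pow_eq_one_of_minimal_not_centralized`). Hence `R` lies in a subgroup `S`
of order at least `pd` which either has no elements of order greater than `d`, in which case `S` and
its maximal subgroups are generated by subgroups of order `d` and so are `Q`-invariant, or is
cyclic; in both cases `k` centralizes `R`, a contradiction. If `P` is a nonabelian `2`-group and
`d = 2`, the cyclic subgroups of order `4` do the same job directly.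
-/

open scoped commutatorElement

universe u

/-! ### Preliminaries on finite groups -/

theorem Subgroup.eq_top_of_forall_exists_sylow_le {G : Type*} [Group G] [Finite G]
    (H : Subgroup G) (h : ∀ q : ℕ, q.Prime → ∃ Q : Sylow q G, (Q : Subgroup G) ≤ H) : H = ⊤ := by
  apply Subgroup.eq_top_of_le_card
  apply Nat.le_of_dvd Nat.card_pos
  rw [Nat.dvd_iff_prime_pow_dvd_dvd]
  intro q k hq hk
  have := Fact.mk hq
  obtain ⟨Q, hQ⟩ := h q hq
  exact (Q.pow_dvd_card_of_pow_dvd_card hk).trans (Subgroup.card_dvd_of_le hQ)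

theorem Subgroup.mem_of_forall_prime_pow_orderOf {G : Type*} [Group G] [Finite G]
    (H : Subgroup G) (k : G)
    (h : ∀ q : ℕ, q.Prime → ∀ x ∈ Subgroup.zpowers k, (∃ n, x ^ q ^ n = 1) → x ∈ H) : k ∈ H := by
  have : H.subgroupOf (Subgroup.zpowers k) = ⊤ := by
    apply Subgroup.eq_top_of_forall_exists_sylow_le
    intro q hq
    have := Fact.mk hq
    obtain ⟨Q⟩ := (inferInstance : Nonempty (Sylow q (Subgroup.zpowers k)))
    refine ⟨Q, fun x hx => ?_⟩
    rw [Subgroup.mem_subgroupOf]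
    obtain ⟨n, hn⟩ := Q.isPGroup' ⟨x, hx⟩
    refine h q hq x x.2 ⟨n, ?_⟩
    simpa [Subtype.ext_iff] using hn
  rw [Subgroup.subgroupOf_eq_top] at this
  exact this (Subgroup.mem_zpowers k)

theorem IsPGroup.exists_le_card_eq {G : Type*} [Group G] [Finite G] {p d : ℕ} (hp : p.Prime)
    {H T : Subgroup G} (hT : IsPGroup p T) (hHT : H ≤ T) (hd : d ∣ Nat.card T)
    (hHd : Nat.card H ≤ d) : ∃ E : Subgroup G, H ≤ E ∧ E ≤ T ∧ Nat.card E = d := by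
  have := Fact.mk hp
  obtain ⟨n, hn⟩ := IsPGroup.iff_card.1 hT
  obtain ⟨m, hm, rfl⟩ := (Nat.dvd_prime_pow hp).1 (hn ▸ hd)
  obtain ⟨l, hl⟩ := IsPGroup.iff_card.1 (hT.to_le hHT)
  have hlm : l ≤ m := (Nat.pow_le_pow_iff_right hp.one_lt).1 (hl ▸ hHd)
  obtain ⟨E, hE, hHE⟩ := Sylow.exists_subgroup_card_pow_prime_le p hd (H.subgroupOf T)
    (by rw [Nat.card_congr (Subgroup.subgroupOfEquivOfLe hHT).toEquiv, hl]) hlm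
  refine ⟨E.map T.subtype, ?_, Subgroup.map_subtype_le E, ?_⟩
  · intro x hx
    exact ⟨⟨x, hHT hx⟩, hHE (by simpa [Subgroup.mem_subgroupOf] using hx), rfl⟩
  · rw [Subgroup.card_map_of_injective T.subtype_injective, hE]

theorem IsPGroup.card_eq_and_le_normalizer_of_covBy {G : Type*} [Group G] [Finite G] {p : ℕ}
    (hp : p.Prime) {M S : Subgroup G} (hS : IsPGroup p S) (h : M ⋖ S) :
    Nat.card S = Nat.card M * p ∧ S ≤ Subgroup.normalizer (M : Set G) := by
  have := Fact.mk hp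
  obtain ⟨n, hn⟩ := IsPGroup.iff_card.1 hS
  obtain ⟨m, hm⟩ := IsPGroup.iff_card.1 (hS.to_le h.le)
  have hcard : Nat.card S = Nat.card M * p := by
    have hlt : m < n := by
      refine (Nat.pow_lt_pow_iff_right hp.one_lt).1 ?_
      rw [← hn, ← hm]
      exact lt_of_not_ge fun h' => h.lt.ne (Subgroup.eq_of_le_of_card_ge h.le h')
    have hdvd : Nat.card M * p ∣ Nat.card S := by
      rw [hm, hn, ← pow_succ]
      exact pow_dvd_pow p hlt
    obtain ⟨E, hME, hES, hE⟩ := hS.exists_le_card_eq hp h.le hdvd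
      (Nat.le_mul_of_pos_right _ hp.pos)
    rcases h.eq_or_eq hME hES with rfl | rfl
    · have h1 := Nat.card_pos (α := E)
      have h2 := hp.two_le
      nlinarith
    · exact hE
  refine ⟨hcard, ?_⟩
  have hidx : (M.subgroupOf S).index = p := by
    have h1 := (M.subgroupOf S).card_mul_index
    rw [Nat.card_congr (Subgroup.subgroupOfEquivOfLe h.le).toEquiv, hcard] at h1
    exact Nat.eq_of_mul_eq_mul_left Nat.card_pos h1
  have hn0 : n ≠ 0 := by
    rintro rfl
    have h1 := Nat.card_pos (α := M)
    have h2 := hp.two_le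
    rw [hn, pow_zero] at hcard
    nlinarith
  have : (M.subgroupOf S).Normal := by
    apply Subgroup.normal_of_index_eq_minFac_card
    rw [hidx, hn, hp.pow_minFac hn0]
  exact Subgroup.le_normalizer_of_normal_subgroupOf h.le

theorem Subgroup.le_normalizer_of_le_isCyclic {G : Type*} [Group G]
    {Q Z M : Subgroup G} [IsCyclic Z] (hQ : Q ≤ Subgroup.normalizer (Z : Set G)) (hM : M ≤ Z) :
    Q ≤ Subgroup.normalizer (M : Set G) := by
  refine Subgroup.le_normalizer_iff.2 fun a ha x hx => ?_
  obtain ⟨n, hn⟩ :=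
    MonoidHom.map_cyclic (Z.normalizerMonoidHom ⟨a, hQ ha⟩).toMonoidHom
  have : a * x * a⁻¹ = x ^ n := congrArg Subtype.val (hn ⟨x, hM hx⟩)
  rw [this]
  exact zpow_mem hx n

/-! ### Coprime action on `p`-groups -/

/-- A `q`-element acting on a coset of a `p`-subgroup `M` has a fixed point on it if `q ≠ p`,
since the size of the coset is prime to `q`. -/
theorem exists_commute_mul_of_coset_invariant {G : Type*} [Group G] [Finite G] {p q n : ℕ}
    (hp : p.Prime) (hq : q.Prime) (hpq : q ≠ p) {k x : G} {M : Subgroup G} (hM : IsPGroup p M)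
    (hk : k ^ q ^ n = 1) (hkM : k ∈ Subgroup.normalizer (M : Set G))
    (hx : x⁻¹ * (k * x * k⁻¹) ∈ M) : ∃ m ∈ M, Commute k (x * m) := by
  have := Fact.mk hp
  have := Fact.mk hq
  let c : Equiv.Perm G := (MulAut.conj k).toEquiv
  have hc : ∀ y, x⁻¹ * c y ∈ M ↔ x⁻¹ * y ∈ M := by
    intro y
    have : x⁻¹ * c y = (x⁻¹ * (k * x * k⁻¹)) * (k * (x⁻¹ * y) * k⁻¹) := by
      change x⁻¹ * (k * y * k⁻¹) = _
      group
    rw [this, M.mul_mem_cancel_left hx]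
    exact ((Subgroup.mem_normalizer_iff.1 hkM) _).symm
  let σ : Equiv.Perm {y : G // x⁻¹ * y ∈ M} := c.subtypePerm hc
  let e : M ≃ {y : G // x⁻¹ * y ∈ M} :=
    { toFun := fun m => ⟨x * m, by simp⟩
      invFun := fun y => ⟨x⁻¹ * y, y.2⟩
      left_inv := fun m => by simp
      right_inv := fun y => by simp }
  have := Fintype.ofFinite {y : G // x⁻¹ * y ∈ M}
  have hcpow : ∀ (j : ℕ) (y : G), (c ^ j) y = k ^ j * y * (k ^ j)⁻¹ := by
    intro j
    induction j with
    | zero => intro y; simp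
    | succ j ih =>
      intro y
      rw [pow_succ, Equiv.Perm.mul_apply, ih]
      change k ^ j * (k * y * k⁻¹) * (k ^ j)⁻¹ = _
      rw [pow_succ]
      group
  have hσ : σ ^ q ^ n = 1 := by
    ext y
    rw [Equiv.Perm.subtypePerm_pow]
    simp [hcpow, hk]
  have hcard : ¬ q ∣ Fintype.card {y : G // x⁻¹ * y ∈ M} := by
    rw [← Nat.card_eq_fintype_card, ← Nat.card_congr e]
    obtain ⟨m, hm⟩ := IsPGroup.iff_card.1 hM
    rw [hm]
    intro h
    exact hpq ((Nat.prime_dvd_prime_iff_eq hq hp).1 (hq.dvd_of_dvd_pow h))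
  obtain ⟨y, hy⟩ := Equiv.Perm.exists_fixed_point_of_prime hcard hσ
  have hy' : k * y * k⁻¹ = y := congrArg Subtype.val hy
  refine ⟨x⁻¹ * y, y.2, ?_⟩
  rw [mul_inv_cancel_left]
  exact mul_inv_eq_iff_eq_mul.1 hy'

/-- A `p'`-element `k` acting trivially on the Frattini quotient of a `p`-group `S` centralizes `S`:
for a power of `k` of prime power order, a maximal subgroup containing its centralizer in `S` would
contain a fixed point on each of its cosets. -/
theorem mem_centralizer_of_forall_covBy {G : Type*} [Group G] [Finite G] {p : ℕ}
    (hp : p.Prime) {k : G} (hk : (orderOf k).Coprime p) {S : Subgroup G} (hS : IsPGroup p S)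
    (h : ∀ M : Subgroup G, M ⋖ S →
      k ∈ Subgroup.normalizer (M : Set G) ∧ ∀ x ∈ S, x⁻¹ * (k * x * k⁻¹) ∈ M) :
    k ∈ Subgroup.centralizer (S : Set G) := by
  refine Subgroup.mem_of_forall_prime_pow_orderOf _ k ?_
  rintro q hq l hl ⟨n, hn⟩
  have hlord : orderOf l ∣ orderOf k := by
    obtain ⟨i, rfl⟩ := Subgroup.mem_zpowers_iff.1 hl
    exact orderOf_dvd_of_pow_eq_one (by rw [← zpow_natCast, zpow_comm, zpow_natCast,
      pow_orderOf_eq_one, one_zpow])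
  by_cases hqp : q = p
  · have h1 : orderOf l ∣ p ^ n := orderOf_dvd_of_pow_eq_one (hqp ▸ hn)
    have h2 : orderOf l = 1 :=
      Nat.eq_one_of_dvd_coprimes (hk.pow_right n) hlord h1
    rw [orderOf_eq_one_iff.1 h2]
    exact one_mem _
  -- the elements acting trivially on `S / M` form a subgroup, so `l` is one of them
  have hl' : ∀ M : Subgroup G, M ⋖ S →
      l ∈ Subgroup.normalizer (M : Set G) ∧ ∀ x ∈ S, x⁻¹ * (l * x * l⁻¹) ∈ M := by
    intro M hM
    obtain ⟨h1, h2⟩ := h M hM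
    have hpow : ∀ i : ℕ, ∀ x ∈ S, x⁻¹ * (k ^ i * x * (k ^ i)⁻¹) ∈ M := by
      intro i
      induction i with
      | zero => intro x _; simp
      | succ i ih =>
        intro x hx
        have h3 := (Subgroup.mem_normalizer_iff.1 (pow_mem h1 i) _).1 (h2 x hx)
        have := mul_mem (ih x hx) h3
        convert this using 1
        rw [pow_succ]
        group
    obtain ⟨i, rfl⟩ : ∃ i : ℕ, k ^ i = l := (mem_powers_iff_mem_zpowers.2 hl)
    exact ⟨pow_mem h1 i, hpow i⟩
  by_contra hcon
  have hlt : S ⊓ Subgroup.centralizer {l} < S := by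
    refine lt_of_le_of_ne inf_le_left fun h' => hcon ?_
    rw [Subgroup.mem_centralizer_iff]
    intro x hx
    have : x ∈ S ⊓ Subgroup.centralizer {l} := by rw [h']; exact hx
    exact ((Subgroup.mem_centralizer_singleton_iff.1 this.2))
  obtain ⟨M, hM, hMS⟩ := exists_le_covBy_of_lt hlt
  obtain ⟨x, hxS, hxM⟩ := SetLike.exists_of_lt hMS.lt
  obtain ⟨h1, h2⟩ := hl' M hMS
  obtain ⟨m, hm, hcomm⟩ := exists_commute_mul_of_coset_invariant hp hq hqp
    (hS.to_le hMS.le) hn h1 (h2 x hxS)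
  have : x * m ∈ M := hM ⟨mul_mem hxS (hMS.le hm),
    Subgroup.mem_centralizer_singleton_iff.2 hcomm.symm.eq⟩
  exact hxM ((M.mul_mem_cancel_right hm).1 this)

/-- If `k` fixes `y` and sends `x` to `x * y`, then `k ^ i` sends `x` to `x * y ^ i`, so `y = 1` when
the orders of `k` and `y` are coprime. -/
theorem commute_of_conj_eq_mul {G : Type*} [Group G] {k x y : G}
    (hk : (orderOf k).Coprime (orderOf y)) (hxy : k * x * k⁻¹ = x * y) (hky : Commute k y) :
    Commute k x := by
  have hpow : ∀ i : ℕ, k ^ i * x * (k ^ i)⁻¹ = x * y ^ i := by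
    intro i
    induction i with
    | zero => simp
    | succ i ih =>
      have h1 : k ^ (i + 1) * x * (k ^ (i + 1))⁻¹ = k * (k ^ i * x * (k ^ i)⁻¹) * k⁻¹ := by
        rw [pow_succ']; group
      have h2 : k * y ^ i = y ^ i * k := (hky.pow_right i).eq
      rw [h1, ih, pow_succ']
      calc k * (x * y ^ i) * k⁻¹ = (k * x * k⁻¹) * (k * y ^ i) * k⁻¹ := by group
        _ = x * (y * y ^ i) := by rw [hxy, h2]; group
  have h1 := hpow (orderOf k)
  rw [pow_orderOf_eq_one] at h1
  have h2 : y ^ orderOf k = 1 := by simpa using h1.symm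
  have h3 : y = 1 := orderOf_eq_one_iff.1
    (Nat.eq_one_of_dvd_coprimes hk (orderOf_dvd_of_pow_eq_one h2) dvd_rfl)
  rw [h3, mul_one] at hxy
  exact mul_inv_eq_iff_eq_mul.1 hxy

/-- The power formulas for two elements with central commutator. -/
theorem mul_pow_eq_of_commute {G : Type*} [Group G] {x y c : G} (hx : Commute c x)
    (hy : Commute c y) (h : y * x = x * y * c) (n : ℕ) :
    y ^ n * x = x * y ^ n * c ^ n ∧ (x * y) ^ n = x ^ n * y ^ n * c ^ n.choose 2 := by
  have h1 : ∀ n : ℕ, y ^ n * x = x * y ^ n * c ^ n := by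
    intro n
    induction n with
    | zero => simp
    | succ n ih =>
      calc y ^ (n + 1) * x = y ^ n * (y * x) := by rw [pow_succ, mul_assoc]
        _ = (y ^ n * x) * (y * c) := by rw [h]; group
        _ = x * y ^ n * (c ^ n * y) * c := by rw [ih]; group
        _ = x * y ^ n * (y * c ^ n) * c := by rw [(hy.pow_left n).eq]
        _ = x * y ^ (n + 1) * c ^ (n + 1) := by rw [pow_succ, pow_succ]; group
  refine ⟨h1 n, ?_⟩
  induction n with
  | zero => simp
  | succ n ih =>
    have hc : Commute (c ^ n.choose 2) (x * y) := (hx.mul_right hy).pow_left _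
    calc (x * y) ^ (n + 1) = x ^ n * y ^ n * (c ^ n.choose 2 * (x * y)) := by
          rw [pow_succ, ih]; group
      _ = x ^ n * (y ^ n * x) * y * c ^ n.choose 2 := by rw [hc.eq]; group
      _ = x ^ (n + 1) * y ^ n * (c ^ n * y) * c ^ n.choose 2 := by
          rw [h1, pow_succ]; group
      _ = x ^ (n + 1) * y ^ (n + 1) * (c ^ n * c ^ n.choose 2) := by
          rw [(hy.pow_left n).eq, pow_succ y]; group
      _ = x ^ (n + 1) * y ^ (n + 1) * c ^ (n + 1).choose 2 := by
          rw [← pow_add, Nat.choose_succ_succ' n 1, Nat.choose_one_right]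

/-- If `R` is minimal among the subgroups normalized but not centralized by a `p'`-element `k`,
then `R` has class at most two, its `p`-th powers are central, and the elements
`x⁻¹ * (k * x * k⁻¹)` generate `R`. Hence `R` has exponent dividing every multiple `e` of `p`
for which `x ↦ x ^ e` is a homomorphism on `R`. -/
theorem pow_eq_one_of_minimal_not_centralized {G : Type*} [Group G] [Finite G] {p e : ℕ}
    (hp : p.Prime) {k : G} (hk : (orderOf k).Coprime p) {R : Subgroup G} (hR : IsPGroup p R)
    (hkR : k ∈ Subgroup.normalizer (R : Set G)) (hkC : k ∉ Subgroup.centralizer (R : Set G))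
    (hmin : ∀ Y < R, k ∈ Subgroup.normalizer (Y : Set G) → k ∈ Subgroup.centralizer (Y : Set G))
    (hpe : p ∣ e) (he : p ∣ e.choose 2 ∨ ∀ x ∈ R, ∀ y ∈ R, x * y = y * x) :
    ∀ x ∈ R, x ^ e = 1 := by
  have := Fact.mk hp
  have hkR' : ∀ x ∈ R, k * x * k⁻¹ ∈ R := fun x hx => (Subgroup.mem_normalizer_iff.1 hkR x).1 hx
  have hf : ∀ x ∈ R, x⁻¹ * (k * x * k⁻¹) ∈ R := fun x hx => mul_mem (inv_mem hx) (hkR' x hx)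
  -- the elements `x⁻¹ * (k * x * k⁻¹)` lie in no proper `k`-invariant subgroup of `R`
  have hW : ∀ W ≤ R, k ∈ Subgroup.normalizer (W : Set G) →
      (∀ x ∈ R, x⁻¹ * (k * x * k⁻¹) ∈ W) → W = R := by
    intro W hWR hkW hfW
    by_contra hne
    have hcent := hmin W (lt_of_le_of_ne hWR hne) hkW
    refine hkC (Subgroup.mem_centralizer_iff.2 fun x hx => ?_)
    refine (commute_of_conj_eq_mul (y := x⁻¹ * (k * x * k⁻¹)) ?_ (by group) ?_).symm.eq
    · obtain ⟨m, hm⟩ := IsPGroup.iff_orderOf.1 hR ⟨_, hf x hx⟩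
      rw [Subgroup.orderOf_mk] at hm
      rw [hm]
      exact hk.pow_right m
    · exact (Subgroup.mem_centralizer_iff.1 hcent _ (hfW x hx)).symm
  -- a proper normal `k`-invariant subgroup is central, since `k` fixes it pointwise
  have hY : ∀ Y < R, k ∈ Subgroup.normalizer (Y : Set G) →
      R ≤ Subgroup.normalizer (Y : Set G) → ∀ y ∈ Y, ∀ x ∈ R, Commute y x := by
    intro Y hYR hkY hRY
    have hcent : ∀ y ∈ Y, Commute y k :=
      fun y hy => Subgroup.mem_centralizer_iff.1 (hmin Y hYR hkY) y hy
    have : R ⊓ Subgroup.centralizer (Y : Set G) = R := by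
      apply hW _ inf_le_left
      · refine Subgroup.mem_normalizer_fintype fun w hw => ⟨hkR' w hw.1, ?_⟩
        refine Subgroup.mem_centralizer_iff.2 fun y hy => ?_
        have h1 : Commute y w := Subgroup.mem_centralizer_iff.1 hw.2 y hy
        exact (((hcent y hy).mul_right h1).mul_right (hcent y hy).inv_right).eq
      · intro x hx
        refine ⟨hf x hx, Subgroup.mem_centralizer_iff.2 fun y hy => ?_⟩
        have h1 : Commute (x * y * x⁻¹) k :=
          hcent _ ((Subgroup.mem_normalizer_iff.1 (hRY hx) y).1 hy)
        have h2 : Commute y (x⁻¹ * k * x) := by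
          have := (Commute.conj_iff x⁻¹).2 h1
          convert this using 1 <;> group
        have h3 := (h2.mul_right (hcent y hy).inv_right).eq
        convert h3 using 1 <;> group
    intro y hy x hx
    rw [← this] at hx
    exact Subgroup.mem_centralizer_iff.1 hx.2 y hy
  -- the commutators and the `p`-th powers generate a proper subgroup `Y`
  let s : Set G := {z | (∃ a ∈ R, ∃ b ∈ R, ⁅a, b⁆ = z) ∨ ∃ a ∈ R, a ^ p = z}
  have hsN : ∀ g ∈ Subgroup.normalizer (R : Set G),
      g ∈ Subgroup.normalizer (Subgroup.closure s : Set G) := by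
    intro g hg
    apply Subgroup.normalizer_le_normalizer_closure
    have hgR : ∀ x ∈ R, g * x * g⁻¹ ∈ R := fun x hx => (Subgroup.mem_normalizer_iff.1 hg x).1 hx
    refine Subgroup.mem_normalizer_fintype ?_
    rintro _ (⟨a, ha, b, hb, rfl⟩ | ⟨a, ha, rfl⟩)
    · exact Or.inl ⟨_, hgR a ha, _, hgR b hb, (conjugate_commutatorElement a b g).symm⟩
    · exact Or.inr ⟨_, hgR a ha, conj_pow⟩
  have hlt : Subgroup.closure s < R := by
    have hRbot : ⊥ < R := by
      rw [bot_lt_iff_ne_bot]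
      rintro rfl
      apply hkC
      rw [Subgroup.mem_centralizer_iff]
      rintro x (rfl : x = 1)
      simp
    obtain ⟨M, -, hM⟩ := exists_le_covBy_of_lt hRbot
    refine lt_of_le_of_lt ?_ hM.lt
    obtain ⟨hcard, hN⟩ := hR.card_eq_and_le_normalizer_of_covBy hp hM
    have : (M.subgroupOf R).Normal := Subgroup.normal_subgroupOf_of_le_normalizer hN
    have hidx : (M.subgroupOf R).index = p := by
      have h1 := (M.subgroupOf R).card_mul_index
      rw [Nat.card_congr (Subgroup.subgroupOfEquivOfLe hM.le).toEquiv, hcard] at h1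
      exact Nat.eq_of_mul_eq_mul_left Nat.card_pos h1
    rw [Subgroup.closure_le]
    rintro _ (⟨a, ha, b, hb, rfl⟩ | ⟨a, ha, rfl⟩)
    · have : IsCyclic (R ⧸ M.subgroupOf R) := isCyclic_of_prime_card (p := p) hidx
      have h1 : ((⁅(⟨a, ha⟩ : R), ⟨b, hb⟩⁆ : R) : R ⧸ M.subgroupOf R) = 1 := by
        have h2 : IsMulCommutative (R ⧸ M.subgroupOf R) := IsCyclic.isMulCommutative
        have h3 : ⁅((⟨a, ha⟩ : R) : R ⧸ M.subgroupOf R), ((⟨b, hb⟩ : R) : R ⧸ M.subgroupOf R)⁆ = 1 :=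
          commutatorElement_eq_one_iff_mul_comm.2 (h2.is_comm.comm _ _)
        exact h3
      rw [QuotientGroup.eq_one_iff, Subgroup.mem_subgroupOf] at h1
      exact h1
    · have h1 := Subgroup.pow_index_mem (M.subgroupOf R) ⟨a, ha⟩
      rw [hidx, Subgroup.mem_subgroupOf] at h1
      exact h1
  have hcomm : ∀ z ∈ s, ∀ x ∈ R, Commute z x := fun z hz =>
    hY _ hlt (hsN k hkR) (fun g hg => hsN g (Subgroup.le_normalizer hg)) z
      (Subgroup.subset_closure hz)
  have hkpow : ∀ x ∈ R, Commute (x ^ e) k := by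
    intro x hx
    obtain ⟨f, rfl⟩ := hpe
    rw [pow_mul]
    refine Commute.pow_left (Subgroup.mem_centralizer_iff.1 (hmin _ hlt (hsN k hkR)) _ ?_) f
    exact Subgroup.subset_closure (Or.inr ⟨x, hx, rfl⟩)
  have hmul : ∀ x ∈ R, ∀ y ∈ R, (x * y) ^ e = x ^ e * y ^ e := by
    intro x hx y hy
    rcases he with he | he
    · have hcs : ⁅y⁻¹, x⁻¹⁆ ∈ s := Or.inl ⟨_, inv_mem hy, _, inv_mem hx, rfl⟩
      have h1 := fun n => mul_pow_eq_of_commute (hcomm _ hcs x hx) (hcomm _ hcs y hy)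
        (by rw [commutatorElement_def]; group) n
      have h2 := (h1 p).1
      rw [(hcomm _ (Or.inr ⟨y, hy, rfl⟩) x hx).eq] at h2
      have h3 : ⁅y⁻¹, x⁻¹⁆ ^ p = 1 := by simpa using h2.symm
      obtain ⟨f, hf⟩ := he
      rw [(h1 e).2, hf, pow_mul, h3, one_pow, mul_one]
    · exact (show Commute x y from he x hx y hy).mul_pow e
  let E : Subgroup G :=
    { carrier := {x | x ∈ R ∧ x ^ e = 1}
      mul_mem' := fun {x y} hx hy => ⟨mul_mem hx.1 hy.1, by
        rw [hmul x hx.1 y hy.1, hx.2, hy.2, mul_one]⟩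
      one_mem' := ⟨one_mem R, one_pow e⟩
      inv_mem' := fun {x} hx => ⟨inv_mem hx.1, by rw [inv_pow, hx.2, inv_one]⟩ }
  have hE : E = R := by
    refine hW E (fun x hx => hx.1) ?_ fun x hx => ⟨hf x hx, ?_⟩
    · refine Subgroup.mem_normalizer_fintype fun x hx => ⟨hkR' x hx.1, ?_⟩
      rw [conj_pow, hx.2, mul_one, mul_inv_cancel]
    · rw [hmul _ (inv_mem hx) _ (hkR' x hx), conj_pow, ← (hkpow x hx).eq]
      simp
  intro x hx
  rw [← hE] at hx
  exact hx.2

/-! ### Actions on sections of prime order -/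

theorem pow_sub_one_mem_centralizer_of_card_eq_prime {G : Type*} [Group G] {p : ℕ} (hp : p.Prime)
    {S : Subgroup G} (hS : Nat.card S = p) {a : G} (ha : a ∈ Subgroup.normalizer (S : Set G)) :
    a ^ (p - 1) ∈ Subgroup.centralizer (S : Set G) := by
  have := Fact.mk hp
  have hfin : Finite S := Nat.finite_of_card_ne_zero (hS ▸ hp.ne_zero)
  have : IsCyclic S := isCyclic_of_prime_card hS
  have h1 : (⟨a, ha⟩ : Subgroup.normalizer (S : Set G)) ^ (p - 1) ∈ S.normalizerMonoidHom.ker := by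
    rw [MonoidHom.mem_ker, map_pow]
    have h2 : Nat.card (MulAut S) = p - 1 := by
      rw [IsCyclic.card_mulAut, hS, Nat.totient_prime hp]
    rw [← h2]
    exact pow_card_eq_one'
  rw [Subgroup.normalizerMonoidHom_ker, Subgroup.mem_subgroupOf] at h1
  exact h1

theorem commutator_mem_centralizer_of_isCyclic {G : Type*} [Group G]
    {S : Subgroup G} [IsCyclic S] {a b : G} (ha : a ∈ Subgroup.normalizer (S : Set G))
    (hb : b ∈ Subgroup.normalizer (S : Set G)) :
    ⁅a, b⁆ ∈ Subgroup.centralizer (S : Set G) := by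
  have h1 : ⁅(⟨a, ha⟩ : Subgroup.normalizer (S : Set G)), ⟨b, hb⟩⁆ ∈
      S.normalizerMonoidHom.ker := by
    rw [MonoidHom.mem_ker, map_commutatorElement, commutatorElement_eq_one_iff_mul_comm]
    ext x
    obtain ⟨m, hm⟩ := MonoidHom.map_cyclic (S.normalizerMonoidHom ⟨a, ha⟩).toMonoidHom
    obtain ⟨n, hn⟩ := MonoidHom.map_cyclic (S.normalizerMonoidHom ⟨b, hb⟩).toMonoidHom
    have hm' : ∀ x, S.normalizerMonoidHom ⟨a, ha⟩ x = x ^ m := hm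
    have hn' : ∀ x, S.normalizerMonoidHom ⟨b, hb⟩ x = x ^ n := hn
    rw [MulAut.mul_apply, MulAut.mul_apply, hm', hn', hm', hn', ← zpow_mul, ← zpow_mul, mul_comm]
  rw [Subgroup.normalizerMonoidHom_ker, Subgroup.mem_subgroupOf] at h1
  exact h1

/-- `k` acts trivially on every `Q`-invariant section `S / M` of order `p`. The order is expressed
by `|S| = |M| * p`, and triviality of the action by `x⁻¹ * (k * x * k⁻¹) ∈ M` for `x ∈ S`. -/
def ActsTriviallyOnPrimeSections {G : Type*} [Group G] (p : ℕ) (Q : Subgroup G) (k : G) : Prop :=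
  ∀ M S : Subgroup G, M ≤ S → Q ≤ Subgroup.normalizer (S : Set G) →
    Q ≤ Subgroup.normalizer (M : Set G) → S ≤ Subgroup.normalizer (M : Set G) →
    Nat.card S = Nat.card M * p → ∀ x ∈ S, x⁻¹ * (k * x * k⁻¹) ∈ M

/-- The section `S / M` realized as a subgroup `T` of the quotient `V = N_G(M) / M`. -/
theorem exists_hom_of_section {G : Type u} [Group G] [Finite G] {p : ℕ} {M S : Subgroup G}
    (hMS : M ≤ S) (hS : S ≤ Subgroup.normalizer (M : Set G)) (hcard : Nat.card S = Nat.card M * p) :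
    ∃ (V : Type u) (_ : Group V) (f : Subgroup.normalizer (M : Set G) →* V) (T : Subgroup V),
      Nat.card T = p ∧
      (∀ a : Subgroup.normalizer (M : Set G), (a : G) ∈ Subgroup.normalizer (S : Set G) →
        f a ∈ Subgroup.normalizer (T : Set V)) ∧
      ∀ k : Subgroup.normalizer (M : Set G), f k ∈ Subgroup.centralizer (T : Set V) →
        ∀ x ∈ S, x⁻¹ * (k * x * k⁻¹) ∈ M := by
  let Y := Subgroup.normalizer (M : Set G)
  let M' : Subgroup Y := M.subgroupOf Y
  have hMY : M ≤ Y := hMS.trans hS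
  have : M'.Normal := Subgroup.normal_in_normalizer
  let f : Y →* Y ⧸ M' := QuotientGroup.mk' M'
  refine ⟨Y ⧸ M', inferInstance, f, (S.subgroupOf Y).map f, ?_, ?_, ?_⟩
  · rw [← Subgroup.relIndex_ker, QuotientGroup.ker_mk', Subgroup.relIndex_subgroupOf hS]
    have h1 := Subgroup.card_mul_index (M.subgroupOf S)
    rw [Nat.card_congr (Subgroup.subgroupOfEquivOfLe hMS).toEquiv, hcard] at h1
    exact Nat.eq_of_mul_eq_mul_left Nat.card_pos h1
  · intro a ha
    refine Subgroup.le_normalizer_map f ⟨a, ?_, rfl⟩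
    refine Subgroup.mem_normalizer_iff.2 fun y => ?_
    exact Subgroup.mem_normalizer_iff.1 ha y
  · intro k hk x hx
    have h1 := Subgroup.mem_centralizer_iff.1 hk (f ⟨x, hS hx⟩) ⟨_, hx, rfl⟩
    have h2 : f (⟨x, hS hx⟩⁻¹ * (k * ⟨x, hS hx⟩ * k⁻¹)) = 1 := by
      rw [map_mul, map_mul, map_mul, ← h1, map_inv, map_inv]
      group
    exact (QuotientGroup.eq_one_iff (N := M') _).1 h2

theorem ActsTriviallyOnPrimeSections.pow_sub_one {G : Type*} [Group G] [Finite G] {p : ℕ}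
    (hp : p.Prime) {Q : Subgroup G} {a : G} (ha : a ∈ Q) :
    ActsTriviallyOnPrimeSections p Q (a ^ (p - 1)) := by
  intro M S hMS hQS hQM hSM hcard
  obtain ⟨V, _, f, T, hT, hN, hC⟩ := exists_hom_of_section hMS hSM hcard
  refine hC (⟨a, hQM ha⟩ ^ (p - 1)) ?_
  rw [map_pow]
  exact pow_sub_one_mem_centralizer_of_card_eq_prime hp hT (hN _ (hQS ha))

theorem ActsTriviallyOnPrimeSections.commutator {G : Type*} [Group G] [Finite G] {p : ℕ}
    (hp : p.Prime) {Q : Subgroup G} {a b : G} (ha : a ∈ Q) (hb : b ∈ Q) :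
    ActsTriviallyOnPrimeSections p Q ⁅a, b⁆ := by
  intro M S hMS hQS hQM hSM hcard
  obtain ⟨V, _, f, T, hT, hN, hC⟩ := exists_hom_of_section hMS hSM hcard
  have := Fact.mk hp
  have : IsCyclic T := isCyclic_of_prime_card hT
  refine hC ⁅(⟨a, hQM ha⟩ : Subgroup.normalizer (M : Set G)), ⟨b, hQM hb⟩⁆ ?_
  rw [map_commutatorElement]
  exact commutator_mem_centralizer_of_isCyclic (hN _ (hQS ha)) (hN _ (hQS hb))

/-! ### Invariance of the subgroups of a fixed order -/

theorem le_normalizer_of_forall_card_eq {G : Type*} [Group G] [Finite G] {p d : ℕ} (hp : p.Prime)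
    {Q T : Subgroup G} (hT : IsPGroup p T) (hd : d ∣ Nat.card T)
    (hQ : ∀ E ≤ T, Nat.card E = d → Q ≤ Subgroup.normalizer (E : Set G))
    (hord : ∀ x ∈ T, orderOf x ≤ d) : Q ≤ Subgroup.normalizer (T : Set G) := by
  refine Subgroup.le_normalizer_iff.2 fun a ha x hx => ?_
  obtain ⟨E, hxE, hET, hE⟩ := hT.exists_le_card_eq hp (Subgroup.zpowers_le.2 hx) hd
    (by rw [Nat.card_zpowers]; exact hord x hx)
  exact hET ((Subgroup.mem_normalizer_iff.1 (hQ E hET hE ha) x).1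
    (hxE (Subgroup.mem_zpowers x)))

/-- Let a `p'`-group `Q` normalize every subgroup of order `d` of the `p`-group `P` (and every
cyclic subgroup of order `4` if `P` is a nonabelian `2`-group and `d = 2`), where `1 < d < |P|`.
Then an element of `Q` acting trivially on all `Q`-invariant sections of order `p` centralizes
`P`. -/
theorem mem_centralizer_of_forall_card_eq {G : Type*} [Group G] [Finite G] {p d : ℕ}
    (hp : p.Prime) {P Q : Subgroup G} (hP : IsPGroup p P) (hQ : (Nat.card Q).Coprime p)
    (hQP : Q ≤ Subgroup.normalizer (P : Set G)) (hd1 : 1 < d) (hdP : d < Nat.card P)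
    (hdvd : d ∣ Nat.card P)
    (hinv : ∀ E ≤ P, Nat.card E = d → Q ≤ Subgroup.normalizer (E : Set G))
    (hinv4 : p = 2 → ¬ (∀ x ∈ P, ∀ y ∈ P, x * y = y * x) → d = 2 →
      ∀ C ≤ P, IsCyclic C → Nat.card C = 4 → Q ≤ Subgroup.normalizer (C : Set G))
    {k : G} (hkQ : k ∈ Q) (hk : ActsTriviallyOnPrimeSections p Q k) :
    k ∈ Subgroup.centralizer (P : Set G) := by
  have := Fact.mk hp
  have hkp : (orderOf k).Coprime p :=
    Nat.Coprime.coprime_dvd_left (Subgroup.orderOf_dvd_natCard Q hkQ) hQ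
  obtain ⟨n, hn⟩ := IsPGroup.iff_card.1 hP
  obtain ⟨m, hmn, rfl⟩ := (Nat.dvd_prime_pow hp).1 (hn ▸ hdvd)
  have hmn' : m < n := (Nat.pow_lt_pow_iff_right hp.one_lt).1 (hn ▸ hdP)
  have hm0 : m ≠ 0 := by rintro rfl; simp at hd1
  -- if the maximal subgroups of `S` are `Q`-invariant, then `k` centralizes `S`
  have hcent : ∀ S ≤ P, Q ≤ Subgroup.normalizer (S : Set G) →
      (∀ M, M ⋖ S → Q ≤ Subgroup.normalizer (M : Set G)) →
      k ∈ Subgroup.centralizer (S : Set G) := by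
    intro S hSP hQS hM
    have hS := hP.to_le hSP
    refine mem_centralizer_of_forall_covBy hp hkp hS fun M hMS => ⟨hM M hMS hkQ, ?_⟩
    obtain ⟨h1, h2⟩ := hS.card_eq_and_le_normalizer_of_covBy hp hMS
    exact hk M S hMS.le hQS (hM M hMS) h2 h1
  have hcyc : ∀ Z ≤ P, IsCyclic Z → Q ≤ Subgroup.normalizer (Z : Set G) →
      k ∈ Subgroup.centralizer (Z : Set G) := fun Z hZP _ hQZ =>
    hcent Z hZP hQZ fun M hM => Subgroup.le_normalizer_of_le_isCyclic hQZ hM.le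
  by_contra hkP
  obtain ⟨R, ⟨hRP, hkR, hkC⟩, hRmin⟩ : ∃ R : Subgroup G,
      (R ≤ P ∧ k ∈ Subgroup.normalizer (R : Set G) ∧ k ∉ Subgroup.centralizer (R : Set G)) ∧
      ∀ Y < R, ¬ (Y ≤ P ∧ k ∈ Subgroup.normalizer (Y : Set G) ∧
        k ∉ Subgroup.centralizer (Y : Set G)) := by
    obtain ⟨R, hR, hmin⟩ := wellFounded_lt.has_min
      {R : Subgroup G | R ≤ P ∧ k ∈ Subgroup.normalizer (R : Set G) ∧
        k ∉ Subgroup.centralizer (R : Set G)} ⟨P, le_rfl, hQP hkQ, hkP⟩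
    exact ⟨R, hR, fun Y hY h => hmin Y h hY⟩
  have hexp : ∀ e, p ∣ e → (p ∣ e.choose 2 ∨ ∀ x ∈ R, ∀ y ∈ R, x * y = y * x) →
      ∀ x ∈ R, x ^ e = 1 := fun e =>
    pow_eq_one_of_minimal_not_centralized hp hkp (hP.to_le hRP) hkR hkC
      fun Y hY hkY => by_contra fun h => hRmin Y hY ⟨hY.le.trans hRP, hkY, h⟩
  by_cases hex : p = 2 ∧ ¬ (∀ x ∈ P, ∀ y ∈ P, x * y = y * x) ∧ m = 1
  · -- all elements of `R` have order dividing `4` and generate `Q`-invariant subgroups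
    obtain ⟨rfl, hnc, rfl⟩ := hex
    have h4 := hexp 4 (by norm_num) (Or.inl (by decide))
    refine hkC (Subgroup.mem_centralizer_iff.2 fun x hx => ?_)
    have hxP : Subgroup.zpowers x ≤ P := Subgroup.zpowers_le.2 (hRP hx)
    have hQx : Q ≤ Subgroup.normalizer (Subgroup.zpowers x : Set G) := by
      have h1 : orderOf x ∣ 2 ^ 2 := orderOf_dvd_of_pow_eq_one (h4 x hx)
      obtain ⟨j, hj, hxj⟩ := (Nat.dvd_prime_pow Nat.prime_two).1 h1
      interval_cases j
      · rw [pow_zero, orderOf_eq_one_iff] at hxj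
        rw [hxj, Subgroup.zpowers_one_eq_bot, Subgroup.normalizer_eq_top]
        exact le_top
      · exact hinv _ hxP (by rw [Nat.card_zpowers, hxj])
      · exact hinv4 rfl hnc rfl _ hxP inferInstance (by rw [Nat.card_zpowers, hxj]; norm_num)
    exact Subgroup.mem_centralizer_iff.1 (hcyc _ hxP inferInstance hQx) x
      (Subgroup.mem_zpowers x)
  -- otherwise all elements of `R` have order at most `d`
  have hord : ∀ x ∈ R, orderOf x ≤ p ^ m := by
    obtain ⟨i, him, hi⟩ : ∃ i ≤ m, ∀ x ∈ R, x ^ p ^ i = 1 := by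
      by_cases h1 : p = 2
      · by_cases h2 : ∀ x ∈ P, ∀ y ∈ P, x * y = y * x
        · exact ⟨1, by omega, hexp _ (by simp)
            (Or.inr fun x hx y hy => h2 x (hRP hx) y (hRP hy))⟩
        · have h3 : m ≠ 1 := fun h => hex ⟨h1, h2, h⟩
          subst h1
          exact ⟨2, by omega, hexp _ (by norm_num) (Or.inl (by decide))⟩
      · refine ⟨1, by omega, hexp _ (by simp) (Or.inl ?_)⟩
        rw [pow_one]
        exact hp.dvd_choose_self (by norm_num) (by have := hp.two_le; omega)
    intro x hx
    exact (Nat.le_of_dvd (pow_pos hp.pos i) (orderOf_dvd_of_pow_eq_one (hi x hx))).trans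
      (Nat.pow_le_pow_right hp.pos him)
  -- subgroups of order at least `d` without elements of order greater than `d` are `Q`-invariant
  have hlarge : ∀ S ≤ P, p ^ (m + 1) ∣ Nat.card S → (∀ x ∈ S, orderOf x ≤ p ^ m) →
      k ∈ Subgroup.centralizer (S : Set G) := by
    intro S hSP hdS hordS
    have key : ∀ T ≤ S, p ^ m ∣ Nat.card T → Q ≤ Subgroup.normalizer (T : Set G) :=
      fun T hTS hdT => le_normalizer_of_forall_card_eq hp (hP.to_le (hTS.trans hSP)) hdT
        (fun E hET => hinv E (hET.trans (hTS.trans hSP))) fun x hx => hordS x (hTS hx)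
    refine hcent S hSP (key S le_rfl ((pow_dvd_pow p m.le_succ).trans hdS)) fun M hM => ?_
    refine key M hM.le ?_
    rw [((hP.to_le hSP).card_eq_and_le_normalizer_of_covBy hp hM).1, pow_succ] at hdS
    exact Nat.dvd_of_mul_dvd_mul_right hp.pos hdS
  obtain ⟨r, hr⟩ := IsPGroup.iff_card.1 (hP.to_le hRP)
  rcases Nat.lt_or_ge m r with hmr | hmr
  · exact hkC (hlarge R hRP (hr ▸ pow_dvd_pow p hmr) hord)
  obtain ⟨T, hRT, hTP, hT⟩ := hP.exists_le_card_eq hp hRP hdvd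
    (hr ▸ Nat.pow_le_pow_right hp.pos hmr)
  obtain ⟨S, hTS, hSP, hS⟩ := hP.exists_le_card_eq hp (d := p ^ (m + 1)) hTP
    (hn ▸ pow_dvd_pow p hmn') (hT ▸ Nat.pow_le_pow_right hp.pos m.le_succ)
  by_cases hordS : ∀ x ∈ S, orderOf x ≤ p ^ m
  · exact hkC (Subgroup.centralizer_le (hRT.trans hTS) (hlarge S hSP (hS ▸ dvd_rfl) hordS))
  · push Not at hordS
    obtain ⟨x, hxS, hx⟩ := hordS
    -- then `S` is cyclic, generated by `x`
    have hxS' : Subgroup.zpowers x = S := by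
      apply Subgroup.eq_of_le_of_card_ge (Subgroup.zpowers_le.2 hxS)
      have h1 : orderOf x ∣ p ^ (m + 1) := hS ▸ Subgroup.orderOf_dvd_natCard S hxS
      obtain ⟨j, hj, hxj⟩ := (Nat.dvd_prime_pow hp).1 h1
      rw [hxj] at hx
      have := (Nat.pow_lt_pow_iff_right hp.one_lt).1 hx
      rw [Nat.card_zpowers, hS, hxj]
      exact Nat.pow_le_pow_right hp.pos (by omega)
    have : IsCyclic S := hxS' ▸ inferInstance
    have : IsCyclic T := isCyclic_of_injective (Subgroup.inclusion hTS)
      (Subgroup.inclusion_injective hTS)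
    exact hkC (Subgroup.centralizer_le hRT (hcyc T hTP this (hinv T hTP hT)))

/-! ### Complements of abelian normal Hall subgroups -/

/-- A complement of an abelian normal Hall subgroup `Z` is the stabilizer of its own class in
`Z.QuotientDiff`, the set of transversals on which Schur–Zassenhaus rests. -/
theorem Subgroup.IsComplement'.exists_stabilizer_eq {G : Type*} [Group G] [Finite G]
    {Z T : Subgroup G} [Z.Normal] [IsMulCommutative Z] (hZ : (Nat.card Z).Coprime Z.index)
    (hT : Z.IsComplement' T) : ∃ α : Z.QuotientDiff, MulAction.stabilizer G α = T := by
  let α : Z.QuotientDiff := Quotient.mk'' ⟨(T : Set G), hT.symm⟩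
  refine ⟨α, ?_⟩
  have h1 : T ≤ MulAction.stabilizer G α := by
    intro t ht
    rw [MulAction.mem_stabilizer_iff]
    have h2 : MulOpposite.op t⁻¹ • (⟨(T : Set G), hT.symm⟩ : Z.LeftTransversal) =
        ⟨(T : Set G), hT.symm⟩ := by
      apply Subtype.ext
      change MulOpposite.op t⁻¹ • (T : Set G) = T
      exact op_smul_coe_set (inv_mem ht)
    exact congrArg Quotient.mk'' h2
  refine (Subgroup.eq_of_le_of_card_ge h1 ?_).symm
  have h2 := hT.card_mul_card
  have h3 := (Subgroup.isComplement'_stabilizer_of_coprime (α := α) hZ).card_mul_card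
  exact (Nat.eq_of_mul_eq_mul_left Nat.card_pos (h3.trans h2.symm)).le

theorem Subgroup.IsComplement'.exists_conj_eq {G : Type*} [Group G] [Finite G]
    {Z T₁ T₂ : Subgroup G} [Z.Normal] [IsMulCommutative Z] (hZ : (Nat.card Z).Coprime Z.index)
    (h₁ : Z.IsComplement' T₁) (h₂ : Z.IsComplement' T₂) :
    ∃ z ∈ Z, ∀ x, x ∈ T₁ → z * x * z⁻¹ ∈ T₂ := by
  obtain ⟨α, rfl⟩ := h₁.exists_stabilizer_eq hZ
  obtain ⟨β, rfl⟩ := h₂.exists_stabilizer_eq hZ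
  obtain ⟨z, hz⟩ := Subgroup.exists_smul_eq hZ α β
  have hz' : (z : G) • α = β := hz
  refine ⟨z, z.2, fun x hx => ?_⟩
  rw [MulAction.mem_stabilizer_iff] at hx ⊢
  rw [← hz', mul_smul, inv_smul_smul, mul_smul, hx]

/-- A Frattini argument for complements: if `Z ≤ K` are normal in `G`, with `Z` an abelian Hall
subgroup of `K`, then `K = ZT` and `G = Z N_G(T)` for a complement `T` of `Z` in `K`. -/
theorem exists_complement_forall_mul_mem_normalizer {G : Type*} [Group G] [Finite G]
    {Z K : Subgroup G} [Z.Normal] [K.Normal] [IsMulCommutative Z] (hZK : Z ≤ K)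
    (hZ : (Nat.card Z).Coprime (Z.relIndex K)) :
    ∃ T : Subgroup G, Z ⊔ T = K ∧ Nat.card T = Z.relIndex K ∧
      ∀ g, ∃ z ∈ Z, z * g ∈ Subgroup.normalizer (T : Set G) := by
  let Z' := Z.subgroupOf K
  have hcZ : Nat.card Z' = Nat.card Z :=
    Nat.card_congr (Subgroup.subgroupOfEquivOfLe hZK).toEquiv
  have hZ' : (Nat.card Z').Coprime Z'.index := by rw [hcZ]; exact hZ
  have hcomm : ∀ a ∈ Z, ∀ b ∈ Z, a * b = b * a := fun a ha b hb => congrArg Subtype.val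
    ((inferInstance : IsMulCommutative Z).is_comm.comm (⟨a, ha⟩ : Z) ⟨b, hb⟩)
  have : IsMulCommutative Z' :=
    ⟨⟨fun a b => Subtype.ext (Subtype.ext (hcomm _ a.2 _ b.2))⟩⟩
  obtain ⟨T, hT⟩ := Subgroup.exists_right_complement'_of_coprime hZ'
  refine ⟨T.map K.subtype, ?_, ?_, fun g => ?_⟩
  · have h1 := hT.sup_eq_top
    have h2 : (Z' ⊔ T).map K.subtype = K := by rw [h1, ← MonoidHom.range_eq_map, K.range_subtype]
    rwa [Subgroup.map_sup, Subgroup.subgroupOf_map_subtype, inf_of_le_left hZK] at h2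
  · rw [Subgroup.card_map_of_injective K.subtype_injective]
    have h1 := hT.card_mul_card
    rw [← Z'.card_mul_index] at h1
    exact Nat.eq_of_mul_eq_mul_left Nat.card_pos h1
  · let c : MulAut K := MulAut.conjNormal g
    have hT' : Z'.IsComplement' (T.map c.toMonoidHom) := by
      have h1 : Nat.card (T.map c.toMonoidHom) = Nat.card T :=
        Subgroup.card_map_of_injective c.injective
      have h2 : Nat.card T = Z'.index := by
        have h1 := hT.card_mul_card
        rw [← Z'.card_mul_index] at h1
        exact Nat.eq_of_mul_eq_mul_left Nat.card_pos h1
      apply Subgroup.isComplement'_of_coprime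
      · rw [h1, hT.card_mul_card]
      · rw [h1, h2]
        exact hZ'
    obtain ⟨z, hz, hzT⟩ := hT'.exists_conj_eq hZ' hT
    refine ⟨z, hz, Subgroup.mem_normalizer_fintype ?_⟩
    rintro _ ⟨t, ht, rfl⟩
    refine ⟨_, hzT (c t) ⟨t, ht, rfl⟩, ?_⟩
    simp only [Subgroup.subtype_apply, Subgroup.coe_mul, Subgroup.coe_inv, c,
      MulAut.conjNormal_apply]
    group

/-! ### Self-centralizing normal `p`-subgroups of `p`-solvable groups -/

theorem IsChiefFactor.comap {G V : Type*} [Group G] [Group V] {f : G →* V}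
    (hf : Function.Surjective f) {M N : Subgroup V} (h : IsChiefFactor M N) :
    IsChiefFactor (M.comap f) (N.comap f) where
  normal_bot := h.normal_bot.comap f
  normal_top := h.normal_top.comap f
  lt := (Subgroup.comap_lt_comap_of_surjective hf).2 h.lt
  eq_or_eq L hL hML hLN := by
    have hker : f.ker ≤ L := le_trans (by
      intro x hx
      rw [Subgroup.mem_comap, (MonoidHom.mem_ker).1 hx]
      exact one_mem M) hML
    have h1 : (L.map f).comap f = L := Subgroup.comap_map_eq_self hker
    have h2 : M ≤ L.map f := by
      rw [← Subgroup.map_comap_eq_self_of_surjective hf M]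
      exact Subgroup.map_mono hML
    have h3 : L.map f ≤ N := by
      rw [← Subgroup.map_comap_eq_self_of_surjective hf N]
      exact Subgroup.map_mono hLN
    rcases h.eq_or_eq (L.map f) (hL.map f hf) h2 h3 with h4 | h4
    · left; rw [← h1, h4]
    · right; rw [← h1, h4]

theorem IsPSolvable.of_surjective {G V : Type*} [Group G] [Group V] {p : ℕ} {f : G →* V}
    (hf : Function.Surjective f) (h : IsPSolvable p G) : IsPSolvable p V := by
  intro M N hMN
  have h1 := h _ _ (hMN.comap hf)
  rwa [Subgroup.relIndex_comap, Subgroup.map_comap_eq_self_of_surjective hf] at h1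

theorem exists_isChiefFactor_le {G : Type*} [Group G] [Finite G] {M C : Subgroup G} [hM : M.Normal]
    [hC : C.Normal] (h : M < C) : ∃ N ≤ C, IsChiefFactor M N := by
  obtain ⟨N, ⟨hN, hMN, hNC⟩, hmin⟩ := wellFounded_lt.has_min
    {N : Subgroup G | N.Normal ∧ M < N ∧ N ≤ C} ⟨C, hC, h, le_rfl⟩
  refine ⟨N, hNC, hM, hN, hMN, fun L hL hML hLN => ?_⟩
  rcases hML.eq_or_lt with h1 | h1
  · exact Or.inl h1.symm
  · rcases hLN.eq_or_lt with h2 | h2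
    · exact Or.inr h2
    · exact absurd h2 (hmin L ⟨hL, h1, hLN.trans hNC⟩)

/-- In a `p`-solvable group without nontrivial normal `p'`-subgroups, the largest normal
`p`-subgroup contains its centralizer. -/
theorem centralizer_normalCore_sylow_le {G : Type*} [Group G] [Finite G] {p : ℕ} (hp : p.Prime)
    (hG : IsPSolvable p G) (P : Sylow p G)
    (hK : ∀ K : Subgroup G, K.Normal → (Nat.card K).Coprime p → K = ⊥) :
    Subgroup.centralizer ((P : Subgroup G).normalCore : Set G) ≤ (P : Subgroup G).normalCore := by
  have := Fact.mk hp
  set U := (P : Subgroup G).normalCore with hU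
  set C := Subgroup.centralizer (U : Set G) with hC
  have hUp : IsPGroup p U := P.2.to_le (Subgroup.normalCore_le _)
  let Z := C ⊓ U
  have hZp : IsPGroup p Z := hUp.to_le inf_le_right
  have hUn : U.Normal := Subgroup.normalCore_normal _
  have hCn : C.Normal := Subgroup.normal_centralizer
  have hZn : Z.Normal := inferInstance
  by_contra hCU
  have hZC : Z < C := lt_of_le_of_ne inf_le_left fun h => hCU (inf_eq_left.1 h)
  obtain ⟨N, hNC, hN⟩ := exists_isChiefFactor_le hZC
  have hNn := hN.normal_top
  have hZN : Z.relIndex N * Nat.card Z = Nat.card N := by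
    rw [mul_comm, ← Nat.card_congr (Subgroup.subgroupOfEquivOfLe hN.lt.le).toEquiv]
    exact Subgroup.card_mul_index _
  obtain ⟨z, hz⟩ := IsPGroup.iff_card.1 hZp
  have hZcomm : ∀ a ∈ Z, ∀ b ∈ C, a * b = b * a :=
    fun a ha b hb => Subgroup.mem_centralizer_iff.1 hb a ha.2
  rcases hG _ _ hN with ⟨n, hn⟩ | hn
  · -- then `N` is a normal `p`-subgroup, so it lies in `U`
    have hNp : IsPGroup p N := IsPGroup.of_card (n := n + z) (by rw [← hZN, hn, hz, pow_add])
    have hNU : N ≤ U := Subgroup.normal_le_normalCore.2 (hNp.le_sylow_of_normal P)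
    exact hN.lt.not_ge (le_inf hNC hNU)
  · have hcop : (Z.relIndex N).Coprime p := ((Nat.Prime.coprime_iff_not_dvd hp).2 hn).symm
    have : IsMulCommutative Z :=
      ⟨⟨fun a b => Subtype.ext (hZcomm a a.2 b b.2.1)⟩⟩
    obtain ⟨T, hZT, hTc, hTN⟩ := exists_complement_forall_mul_mem_normalizer hN.lt.le
      (by rw [hz]; exact (hcop.pow_right z).symm)
    have hTn : T.Normal := by
      refine Subgroup.normalizer_eq_top_iff.1 (eq_top_iff.2 fun g _ => ?_)
      obtain ⟨a, ha, hag⟩ := hTN g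
      refine ((Subgroup.normalizer _).mul_mem_cancel_left ?_).1 hag
      refine Subgroup.mem_normalizer_fintype fun t ht => ?_
      have h1 : t ∈ C := hNC (hZT ▸ (le_sup_right : T ≤ Z ⊔ T) ht)
      rw [hZcomm a ha t h1]
      simpa using ht
    have hT := hK T hTn (hTc ▸ hcop)
    rw [hT, sup_bot_eq] at hZT
    exact hN.lt.ne hZT

/-- If `HS` is a subgroup, `H, U ≤ P` and `P ∩ S = 1`, then `HS ∩ U = H ∩ U`. -/
theorem SubgroupsPermute.le_normalizer_inf {G : Type*} [Group G] {H S P U : Subgroup G}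
    (hHS : SubgroupsPermute H S) (hHP : H ≤ P) (hUP : U ≤ P) (hPS : P ⊓ S = ⊥)
    (hSU : S ≤ Subgroup.normalizer (U : Set G)) :
    S ≤ Subgroup.normalizer ((H ⊓ U : Subgroup G) : Set G) := by
  refine Subgroup.le_normalizer_iff.2 fun s hs x hx => ?_
  have hU : s * x * s⁻¹ ∈ U := (Subgroup.mem_normalizer_iff.1 (hSU hs) x).1 hx.2
  refine ⟨?_, hU⟩
  have h1 : s * x ∈ (H : Set G) * (S : Set G) := by
    rw [show (H : Set G) * (S : Set G) = (S : Set G) * (H : Set G) from hHS]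
    exact Set.mul_mem_mul hs hx.1
  obtain ⟨h, hh, t, ht, hht⟩ := Set.mem_mul.1 h1
  have h2 : s * x * s⁻¹ = h * (t * s⁻¹) := by rw [← hht]; group
  have h3 : t * s⁻¹ ∈ P ⊓ S := by
    refine ⟨?_, S.mul_mem ht (S.inv_mem hs)⟩
    rw [h2] at hU
    exact (mul_mem_cancel_left (hHP hh)).1 (hUP hU)
  rw [hPS, Subgroup.mem_bot] at h3
  rw [h2, h3, mul_one]
  exact hh

/-! ### Normality of a Sylow subgroup modulo a normal `p'`-subgroup -/

/-- `H` is a subgroup of the subgroup `P` containing `P'`, consisting of nongenerators of `P` and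
permuting with every Sylow `q`-subgroup of `G` for `q ≠ p`. Membership in the Frattini subgroup is
replaced by the nongenerator property `P = HT → P = T`, which passes to quotients of `G`. -/
structure IsPermutableNongenerator {G : Type*} [Group G] (p : ℕ) (P H : Subgroup G) : Prop where
  commutator_le : ⁅P, P⁆ ≤ H
  le : H ≤ P
  nongenerating : ∀ T ≤ P, P ≤ H ⊔ T → P ≤ T
  permute : ∀ q : ℕ, q.Prime → q ≠ p → ∀ S : Sylow q G, SubgroupsPermute H (S : Subgroup G)

theorem IsPermutableNongenerator.map {G V : Type*} [Group G] [Group V] [Finite G] {p : ℕ}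
    {P H : Subgroup G} (h : IsPermutableNongenerator p P H) {f : G →* V}
    (hf : Function.Surjective f) : IsPermutableNongenerator p (P.map f) (H.map f) where
  commutator_le := by
    rw [← Subgroup.map_commutator]
    exact Subgroup.map_mono h.commutator_le
  le := Subgroup.map_mono h.le
  nongenerating T hT hPT := by
    have h1 : P ≤ T.comap f ⊓ P := by
      apply h.nongenerating _ inf_le_right
      intro x hx
      have h2 : T ≤ (T.comap f ⊓ P).map f := by
        intro t ht
        obtain ⟨y, hy, rfl⟩ := hT ht
        exact ⟨y, ⟨ht, hy⟩, rfl⟩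
      have h3 : f x ∈ (H ⊔ (T.comap f ⊓ P)).map f := by
        rw [Subgroup.map_sup]
        exact (sup_le_sup_left h2 _) (hPT ⟨x, hx, rfl⟩)
      obtain ⟨y, hy, hyx⟩ := h3
      have hyP : y ∈ P := (sup_le h.le inf_le_right) hy
      have h4 : y⁻¹ * x ∈ T.comap f ⊓ P := by
        refine Subgroup.mem_inf.2 ⟨?_, mul_mem (inv_mem hyP) hx⟩
        rw [Subgroup.mem_comap, map_mul, map_inv, hyx, inv_mul_cancel]
        exact one_mem T
      rw [← mul_inv_cancel_left y x]
      exact mul_mem hy ((le_sup_right : _ ≤ H ⊔ (T.comap f ⊓ P)) h4)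
    rintro _ ⟨x, hx, rfl⟩
    exact (h1 hx).1
  permute q hq hqp S := by
    have := Fact.mk hq
    obtain ⟨S, rfl⟩ := Sylow.mapSurjective_surjective hf q S
    have h1 : (H : Set G) * (S : Set G) = (S : Set G) * (H : Set G) := h.permute q hq hqp S
    unfold SubgroupsPermute
    rw [Sylow.coe_mapSurjective, Subgroup.coe_map, Subgroup.coe_map, ← Set.image_mul,
      ← Set.image_mul, Sylow.coe_coe, h1]

theorem Sylow.inf_eq_bot_of_ne {G : Type*} [Group G] {p q : ℕ} (hp : p.Prime)
    (hq : q.Prime) (h : q ≠ p) (P : Sylow p G) (Q : Sylow q G) :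
    (P : Subgroup G) ⊓ (Q : Subgroup G) = ⊥ := by
  have := Fact.mk hp
  have := Fact.mk hq
  exact (IsPGroup.disjoint_of_ne p q h.symm _ _ P.2 Q.2).eq_bot

theorem IsPermutableNongenerator.inf_normalCore_normal {G : Type*} [Group G] [Finite G] {p : ℕ}
    (hp : p.Prime) {P : Sylow p G} {H : Subgroup G}
    (h : IsPermutableNongenerator p (P : Subgroup G) H) :
    (H ⊓ (P : Subgroup G).normalCore).Normal := by
  have hU : (P : Subgroup G).normalCore.Normal := Subgroup.normalCore_normal _
  refine Subgroup.normalizer_eq_top_iff.1 (Subgroup.eq_top_of_forall_exists_sylow_le _ ?_)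
  intro q hq
  by_cases hqp : q = p
  · subst hqp
    refine ⟨P, Subgroup.le_normalizer_iff.2 fun g hg x hx => ⟨?_, hU.conj_mem x hx.2 g⟩⟩
    have h1 : ⁅g, x⁆ ∈ H := h.commutator_le (Subgroup.commutator_mem_commutator hg (h.le hx.1))
    have h2 := mul_mem h1 hx.1
    rwa [commutatorElement_def, inv_mul_cancel_right] at h2
  · have := Fact.mk hq
    obtain ⟨S⟩ := (inferInstance : Nonempty (Sylow q G))
    refine ⟨S, (h.permute q hq hqp S).le_normalizer_inf h.le (Subgroup.normalCore_le _)
      (Sylow.inf_eq_bot_of_ne hp hq hqp P S) Subgroup.le_normalizer_of_normal⟩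

theorem Subgroup.normal_comap_sup_of_map_sup {G V : Type*} [Group G] [Group V] {f : G →* V}
    (hf : Function.Surjective f) {P : Subgroup G} {K : Subgroup V} (h : (K ⊔ P.map f).Normal) :
    (K.comap f ⊔ P).Normal := by
  have h1 : (K.comap f ⊔ P).map f = K ⊔ P.map f := by
    rw [Subgroup.map_sup, Subgroup.map_comap_eq_self_of_surjective hf]
  have h2 : f.ker ≤ K.comap f ⊔ P := le_sup_of_le_left (by
    intro x hx
    rw [Subgroup.mem_comap, (MonoidHom.mem_ker).1 hx]
    exact one_mem K)
  rw [← Subgroup.comap_map_eq_self h2, h1]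
  exact h.comap f

/-- In a `p`-solvable group, a Sylow `p`-subgroup `P` with a subgroup `H` as in
`IsPermutableNongenerator` is normal modulo a normal `p'`-subgroup. -/
theorem IsPermutableNongenerator.exists_normal_sup_normal {p : ℕ} (hp : p.Prime) (n : ℕ) :
    ∀ {G : Type u} [Group G] [Finite G], Nat.card G = n → IsPSolvable p G →
      ∀ (P : Sylow p G) (H : Subgroup G), IsPermutableNongenerator p (P : Subgroup G) H →
        ∃ K : Subgroup G, K.Normal ∧ (Nat.card K).Coprime p ∧ (K ⊔ (P : Subgroup G)).Normal := by
  have := Fact.mk hp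
  induction n using Nat.strong_induction_on with
  | _ n ih =>
  intro G _ _ hn hG P H h
  -- apply induction to `G / N`, and record the orders of the subgroups involved
  have step : ∀ N : Subgroup G, N.Normal → N ≠ ⊥ → ∃ K : Subgroup G, K.Normal ∧ N ≤ K ∧
      (N.relIndex K).Coprime p ∧ (K ⊔ (P : Subgroup G)).Normal := by
    intro N hN hN1
    have hf := QuotientGroup.mk'_surjective N
    have hcard : Nat.card (G ⧸ N) < n := by
      rw [← hn, Subgroup.card_eq_card_quotient_mul_card_subgroup N]
      exact lt_mul_of_one_lt_right Nat.card_pos ((Subgroup.one_lt_card_iff_ne_bot N).2 hN1)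
    obtain ⟨K, hK, hKp, hKP⟩ := ih _ hcard rfl (hG.of_surjective hf) (P.mapSurjective hf) _
      (by rw [Sylow.coe_mapSurjective]; exact h.map hf)
    refine ⟨K.comap (QuotientGroup.mk' N), hK.comap _, ?_, ?_, ?_⟩
    · exact QuotientGroup.le_comap_mk' N K
    · have h1 := Subgroup.relIndex_ker (K := K.comap (QuotientGroup.mk' N)) (QuotientGroup.mk' N)
      rw [QuotientGroup.ker_mk', Subgroup.map_comap_eq_self_of_surjective hf] at h1
      rwa [h1]
    · exact Subgroup.normal_comap_sup_of_map_sup hf hKP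
  have hcard_mul : ∀ {N K : Subgroup G}, N ≤ K → Nat.card N * N.relIndex K = Nat.card K := by
    intro N K hNK
    rw [← Nat.card_congr (Subgroup.subgroupOfEquivOfLe hNK).toEquiv]
    exact Subgroup.card_mul_index _
  by_cases hcore : ∀ K : Subgroup G, K.Normal → (Nat.card K).Coprime p → K = ⊥
  swap
  · push Not at hcore
    obtain ⟨N, hN, hNp, hN1⟩ := hcore
    obtain ⟨K, hK, hNK, hKp, hKP⟩ := step N hN hN1
    exact ⟨K, hK, hcard_mul hNK ▸ hNp.mul_left hKp, hKP⟩
  -- it remains to show that `P` itself is normal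
  suffices hPn : (P : Subgroup G).Normal from
    ⟨⊥, inferInstance, by simp, by rwa [bot_sup_eq]⟩
  have hLn := h.inf_normalCore_normal hp
  set U := (P : Subgroup G).normalCore with hU
  have hUP : U ≤ P := Subgroup.normalCore_le _
  by_cases hL : H ⊓ U = ⊥
  · have hCU := centralizer_normalCore_sylow_le hp hG P hcore
    have hUn : U.Normal := Subgroup.normalCore_normal _
    have hcomm : ∀ x ∈ (P : Subgroup G), ∀ u ∈ U, ⁅x, u⁆ ∈ H ⊓ U := fun x hx u hu =>
      Subgroup.mem_inf.2 ⟨h.commutator_le (Subgroup.commutator_mem_commutator hx (hUP hu)),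
        mul_mem (hUn.conj_mem u hu x) (inv_mem hu)⟩
    have hPU : (P : Subgroup G) ≤ U := by
      intro x hx
      refine hCU (Subgroup.mem_centralizer_iff.2 fun u hu => ?_)
      have h1 := hcomm x hx u hu
      rw [hL, Subgroup.mem_bot, commutatorElement_eq_one_iff_mul_comm] at h1
      exact h1.symm
    rw [le_antisymm hPU hUP]
    exact hUn
  · have hLp : IsPGroup p (H ⊓ U : Subgroup G) := P.2.to_le (inf_le_left.trans h.le)
    have : Nontrivial (H ⊓ U : Subgroup G) := (Subgroup.nontrivial_iff_ne_bot _).2 hL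
    let Z : Subgroup G := (Subgroup.center (H ⊓ U : Subgroup G)).map (H ⊓ U).subtype
    have hZn : Z.Normal := ConjAct.normal_of_characteristic_of_normal
    have hZL : Z ≤ H ⊓ U := Subgroup.map_subtype_le _
    have hZ1 : Z ≠ ⊥ := by
      intro hZ
      have := (Subgroup.map_eq_bot_iff_of_injective _ (Subgroup.subtype_injective _)).1 hZ
      exact hLp.bot_lt_center.ne this.symm
    have hZc : IsMulCommutative Z := inferInstance
    obtain ⟨K, hK, hZK, hKp, hKP⟩ := step Z hZn hZ1
    obtain ⟨z, hz⟩ := IsPGroup.iff_card.1 (hLp.to_le hZL)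
    obtain ⟨T, hZT, hTc, hTN⟩ := exists_complement_forall_mul_mem_normalizer hZK
      (by rw [hz]; exact (hKp.pow_right z).symm)
    have hZP : Z ≤ P := hZL.trans (inf_le_left.trans h.le)
    have hPT : (P : Subgroup G) ≤ Subgroup.normalizer (T : Set G) := by
      refine le_trans (h.nongenerating ((P : Subgroup G) ⊓ Subgroup.normalizer (T : Set G)) inf_le_left ?_)
        inf_le_right
      intro x hx
      obtain ⟨a, ha, hax⟩ := hTN x
      rw [← inv_mul_cancel_left a x]
      have haH : a ∈ H := (hZL ha).1
      exact Subgroup.mul_mem_sup (inv_mem haH) (Subgroup.mem_inf.2 ⟨mul_mem (hZP ha) hx, hax⟩)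
    have hTn : T.Normal := by
      refine Subgroup.normalizer_eq_top_iff.1 (eq_top_iff.2 fun g _ => ?_)
      obtain ⟨a, ha, hag⟩ := hTN g
      exact (mul_mem_cancel_left (hPT (hZP ha))).1 hag
    have hT := hcore T hTn (hTc ▸ hKp)
    rw [hT, sup_bot_eq] at hZT
    rwa [← hZT, sup_eq_right.2 hZP] at hKP

/-! ### Chief factors of order `p` -/

theorem Module.End.exists_hasEigenvalue_of_pow_eq_self {p : ℕ} [hp : Fact p.Prime] {A : Type*}
    [AddCommGroup A] [Module (ZMod p) A] [Finite A] [Nontrivial A]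
    {f : Module.End (ZMod p) A} (hf : f ^ p = f) : ∃ c, f.HasEigenvalue c := by
  have hdvd : minpoly (ZMod p) f ∣ Polynomial.X ^ p - Polynomial.X := by
    apply minpoly.dvd
    simp [hf]
  have hint : IsIntegral (ZMod p) f := Algebra.IsIntegral.isIntegral f
  have hdeg : (minpoly (ZMod p) f).degree ≠ 0 := (minpoly.degree_pos hint).ne'
  have hX : (Polynomial.X ^ p - Polynomial.X : Polynomial (ZMod p)).Splits := by
    have := Polynomial.splits_X_pow_nat_card_sub_X (K := ZMod p)
    rwa [Nat.card_zmod] at this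
  have hsplit : (minpoly (ZMod p) f).Splits :=
    hX.of_dvd (FiniteField.X_pow_card_sub_X_ne_zero _ hp.out.one_lt) hdvd
  obtain ⟨c, hc⟩ := hsplit.exists_eval_eq_zero hdeg
  exact ⟨c, Module.End.hasEigenvalue_of_isRoot hc⟩

theorem AddMonoidHom.exists_apply_eq_nsmul {A : Type*} [AddCommGroup A] [Finite A] [Nontrivial A]
    {p : ℕ} (hp : p.Prime) (hA : ∀ v : A, p • v = 0) (φ : A →+ A) (hφ : φ^[p] = φ) :
    ∃ v : A, v ≠ 0 ∧ ∃ i : ℕ, φ v = i • v := by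
  have := Fact.mk hp
  let inst : Module (ZMod p) A := AddCommGroup.zmodModule hA
  obtain ⟨c, hc⟩ := Module.End.exists_hasEigenvalue_of_pow_eq_self
    (f := φ.toZModLinearMap p) (by
      ext v
      rw [Module.End.pow_apply]
      exact congrFun hφ v)
  obtain ⟨v, hv⟩ := hc.exists_hasEigenvector
  refine ⟨v, hv.2, c.val, ?_⟩
  have h1 : φ v = c • v := hv.apply_eq_smul
  rw [← Nat.cast_smul_eq_nsmul (ZMod p), ZMod.natCast_zmod_val]
  exact h1

theorem MulAut.exists_apply_eq_pow {V : Type*} [CommGroup V] [Finite V] [Nontrivial V]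
    {p : ℕ} (hp : p.Prime) (hV : ∀ v : V, v ^ p = 1) (φ : MulAut V) (hφ : φ ^ (p - 1) = 1) :
    ∃ v : V, v ≠ 1 ∧ ∃ i : ℕ, φ v = v ^ i := by
  refine (MonoidHom.toAdditive φ.toMonoidHom).exists_apply_eq_nsmul hp hV ?_
  have hiter : ∀ (j : ℕ) (v : V), φ^[j] v = (φ ^ j) v := by
    intro j
    induction j with
    | zero => intro v; rfl
    | succ j ih =>
      intro v
      rw [Function.iterate_succ_apply, ih, pow_succ, MulAut.mul_apply]
  have hφp : φ ^ p = φ := by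
    conv_lhs => rw [← Nat.sub_add_cancel hp.one_le, pow_succ, hφ, one_mul]
  funext v
  have h := hiter p v.toMul
  rw [hφp] at h
  exact h

theorem IsPGroup.inf_centralizer_ne_bot {G : Type*} [Group G] [Finite G] {p : ℕ} (hp : p.Prime)
    {P V : Subgroup G} [V.Normal] (hP : IsPGroup p P) (hV : IsPGroup p V) (hV1 : V ≠ ⊥) :
    V ⊓ Subgroup.centralizer (P : Set G) ≠ ⊥ := by
  have := Fact.mk hp
  let _ : MulAction P V :=
    MulAction.compHom V ((MulAut.conjNormal (H := V)).comp P.subtype)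
  have hsmul : ∀ (g : P) (v : V), ((g • v : V) : G) = g * v * (g : G)⁻¹ :=
    fun g v => MulAut.conjNormal_apply (g : G) v
  have : Nontrivial V := (Subgroup.nontrivial_iff_ne_bot V).2 hV1
  have hdvd : p ∣ Nat.card V := hV.card_eq_or_dvd.resolve_left (Finite.one_lt_card).ne'
  obtain ⟨v, hv, hv1⟩ := hP.exists_fixed_point_of_prime_dvd_card_of_fixed_point V hdvd
    (a := 1) (fun g => Subtype.ext (by rw [hsmul]; simp))
  intro h
  have h1 : (v : G) ∈ V ⊓ Subgroup.centralizer (P : Set G) := by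
    refine ⟨v.2, Subgroup.mem_centralizer_iff.2 fun g hg => ?_⟩
    have h2 := congrArg Subtype.val (hv ⟨g, hg⟩)
    rw [hsmul] at h2
    exact mul_inv_eq_iff_eq_mul.1 h2
  rw [h, Subgroup.mem_bot] at h1
  exact hv1 (Subtype.ext h1.symm)

/-- A minimal normal `p`-subgroup `V` has order `p` if the group is generated by a normal
`p'`-subgroup `K`, a Sylow `p`-subgroup `P` with `KP` normal, and a subgroup `Q` inducing on `P` an
abelian group of automorphisms of exponent dividing `p - 1`. -/
theorem card_eq_prime_of_minimal_normal {G : Type*} [Group G] [Finite G] {p : ℕ} (hp : p.Prime)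
    {V K Q : Subgroup G} (P : Sylow p G) [V.Normal] [K.Normal] (hV1 : V ≠ ⊥) (hV : IsPGroup p V)
    (hmin : ∀ L : Subgroup G, L.Normal → L ≤ V → L = ⊥ ∨ L = V)
    (hK : (Nat.card K).Coprime p) (hKP : (K ⊔ (P : Subgroup G)).Normal)
    (htop : K ⊔ (P : Subgroup G) ⊔ Q = ⊤)
    (hpow : ∀ a ∈ Q, a ^ (p - 1) ∈ Subgroup.centralizer ((P : Subgroup G) : Set G))
    (hcomm : ∀ a ∈ Q, ∀ b ∈ Q, ⁅a, b⁆ ∈ Subgroup.centralizer ((P : Subgroup G) : Set G)) :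
    Nat.card V = p := by
  have := Fact.mk hp
  have hVP : V ≤ P := hV.le_sylow_of_normal P
  have hVn : V.Normal := inferInstance
  have hVK : Disjoint V K := by
    obtain ⟨n, hn⟩ := IsPGroup.iff_card.1 hV
    exact Subgroup.disjoint_of_coprime_natCard (hn ▸ (hK.pow_right n).symm)
  have hKV : K ≤ Subgroup.centralizer (V : Set G) := by
    intro k hk
    exact Subgroup.mem_centralizer_iff.2 fun v hv =>
      (Subgroup.commute_of_normal_of_disjoint V K inferInstance inferInstance hVK v k hv hk).eq
  -- `KP` centralizes `V`, since its fixed points form a nontrivial normal subgroup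
  have hPV : (P : Subgroup G) ≤ Subgroup.centralizer (V : Set G) := by
    let F := V ⊓ Subgroup.centralizer ((K ⊔ (P : Subgroup G) : Subgroup G) : Set G)
    have hF : F.Normal := inferInstance
    have hF1 : F ≠ ⊥ := by
      intro h
      refine P.2.inf_centralizer_ne_bot hp hV hV1 (eq_bot_iff.2 ?_)
      rw [← h]
      refine le_inf inf_le_left ?_
      rw [Subgroup.le_centralizer_iff]
      refine sup_le ?_ ?_
      · exact hKV.trans (Subgroup.centralizer_le inf_le_left)
      · rw [Subgroup.le_centralizer_iff]
        exact inf_le_right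
    have h1 : V ≤ Subgroup.centralizer ((K ⊔ (P : Subgroup G) : Subgroup G) : Set G) := by
      rw [← (hmin F hF inf_le_left).resolve_left hF1]
      exact inf_le_right
    rw [Subgroup.le_centralizer_iff]
    exact h1.trans (Subgroup.centralizer_le (le_sup_right : (P : Subgroup G) ≤ K ⊔ P))
  have hVcomm : ∀ x ∈ V, ∀ y ∈ V, x * y = y * x := fun x hx y hy =>
    Subgroup.mem_centralizer_iff.1 (hPV (hVP hy)) x hx
  have hQV : ∀ L ≤ V, (∀ a ∈ Q, ∀ x ∈ L, a * x * a⁻¹ ∈ L) → L = ⊥ ∨ L = V := by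
    intro L hLV hL
    refine hmin L (Subgroup.normalizer_eq_top_iff.1 (eq_top_iff.2 ?_)) hLV
    have hC : Subgroup.centralizer (V : Set G) ≤ Subgroup.normalizer (L : Set G) :=
      (Subgroup.centralizer_le hLV).trans (Subgroup.le_normalizer_iff.2 fun g hg x hx => by
        rw [← Subgroup.mem_centralizer_iff.1 hg x hx]; simpa using hx)
    rw [← htop]
    exact sup_le (sup_le (hKV.trans hC) (hPV.trans hC)) (Subgroup.le_normalizer_iff.2 hL)
  let _ : CommGroup V :=
    { (inferInstance : Group V) with mul_comm := fun x y => Subtype.ext (hVcomm x x.2 y y.2) }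
  have hVnt : Nontrivial V := (Subgroup.nontrivial_iff_ne_bot V).2 hV1
  have hexp : ∀ v ∈ V, v ^ p = 1 := by
    let E : Subgroup G :=
      { carrier := {x | x ∈ V ∧ x ^ p = 1}
        mul_mem' := fun {x y} hx hy => ⟨mul_mem hx.1 hy.1, by
          rw [(show Commute x y from hVcomm x hx.1 y hy.1).mul_pow, hx.2, hy.2, mul_one]⟩
        one_mem' := ⟨one_mem V, one_pow p⟩
        inv_mem' := fun {x} hx => ⟨inv_mem hx.1, by rw [inv_pow, hx.2, inv_one]⟩ }
    have hE : E = V := by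
      refine (hQV E (fun x hx => hx.1) fun a _ x hx => ⟨hVn.conj_mem x hx.1 a, ?_⟩).resolve_left ?_
      · rw [conj_pow, hx.2, mul_one, mul_inv_cancel]
      · intro hE
        obtain ⟨v, hv⟩ := exists_prime_orderOf_dvd_card' (G := V) p
          (hV.card_eq_or_dvd.resolve_left (Finite.one_lt_card).ne')
        have h1 : (v : G) ∈ E :=
          ⟨v.2, by rw [← Subgroup.coe_pow, ← hv, pow_orderOf_eq_one, Subgroup.coe_one]⟩
        rw [hE, Subgroup.mem_bot, OneMemClass.coe_eq_one] at h1
        rw [h1, orderOf_one] at hv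
        exact hp.one_lt.ne hv
    intro v hv
    rw [← hE] at hv
    exact hv.2
  -- every `a ∈ Q` has an eigenvector in `V`, and the eigenspace is normal
  have heig : ∀ a ∈ Q, ∃ i : ℕ, ∀ v ∈ V, a * v * a⁻¹ = v ^ i := by
    intro a ha
    obtain ⟨v, hv1, i, hvi⟩ := MulAut.exists_apply_eq_pow hp
      (fun v : V => Subtype.ext (hexp v v.2)) (MulAut.conjNormal a) (by
        rw [← map_pow]
        ext v
        rw [MulAut.conjNormal_apply, MulAut.one_apply,
          ← Subgroup.mem_centralizer_iff.1 (hpow a ha) v (hVP v.2), mul_inv_cancel_right])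
    refine ⟨i, ?_⟩
    let E : Subgroup G :=
      { carrier := {x | x ∈ V ∧ a * x * a⁻¹ = x ^ i}
        mul_mem' := fun {x y} hx hy => ⟨mul_mem hx.1 hy.1, by
          rw [(show Commute x y from hVcomm x hx.1 y hy.1).mul_pow, ← hx.2, ← hy.2]; group⟩
        one_mem' := ⟨one_mem V, by simp⟩
        inv_mem' := fun {x} hx => ⟨inv_mem hx.1, by rw [inv_pow, ← hx.2]; group⟩ }
    have hE : E = V := by
      refine (hQV E (fun x hx => hx.1) fun b hb x hx => ⟨hVn.conj_mem x hx.1 b, ?_⟩).resolve_left ?_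
      · have h1 := Subgroup.mem_centralizer_iff.1 (hcomm a ha b hb) _
          (hVP (hVn.conj_mem _ (hVn.conj_mem x hx.1 a) b))
        calc a * (b * x * b⁻¹) * a⁻¹
            = (⁅a, b⁆ * (b * (a * x * a⁻¹) * b⁻¹)) * ⁅a, b⁆⁻¹ := by
              rw [commutatorElement_def]; group
          _ = b * (a * x * a⁻¹) * b⁻¹ := by rw [← h1, mul_inv_cancel_right]
          _ = (b * x * b⁻¹) ^ i := by rw [hx.2, conj_pow]
      · intro hE
        have h1 : (v : G) ∈ E := ⟨v.2, by
          rw [← MulAut.conjNormal_apply, hvi, Subgroup.coe_pow]⟩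
        rw [hE, Subgroup.mem_bot, OneMemClass.coe_eq_one] at h1
        exact hv1 h1
    intro v hv
    rw [← hE] at hv
    exact hv.2
  obtain ⟨v, hv1⟩ := exists_ne (1 : V)
  have hv1' : (v : G) ≠ 1 := fun h => hv1 (Subtype.ext h)
  have hv : Subgroup.zpowers (v : G) = V := by
    refine (hQV _ (Subgroup.zpowers_le.2 v.2) fun a ha x hx => ?_).resolve_left
      (Subgroup.zpowers_ne_bot.2 hv1')
    obtain ⟨i, hi⟩ := heig a ha
    rw [hi x (Subgroup.zpowers_le.2 v.2 hx)]
    exact pow_mem hx i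
  rw [← hv, Nat.card_zpowers]
  exact orderOf_eq_prime (hexp v v.2) hv1'

/-! ### The normalizer of a Sylow subgroup -/

/-- A complement `Q` of a normal Sylow `p`-subgroup `P` normalizes every `s`-permutable subgroup
`E` of `P`: if `S` is a Sylow `q`-subgroup with `q ≠ p`, then `E` is a normal subgroup
`ES ∩ P` of `ES`. -/
theorem IsSPermutable.le_normalizer {G : Type*} [Group G] [Finite G] {p : ℕ} (hp : p.Prime)
    {P : Sylow p G} (hP : (P : Subgroup G).Normal) {E Q : Subgroup G} (hE : IsSPermutable E)
    (hEP : E ≤ P) (hQ : (Nat.card Q).Coprime p) : Q ≤ Subgroup.normalizer (E : Set G) := by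
  rw [← Subgroup.subgroupOf_eq_top]
  refine Subgroup.eq_top_of_forall_exists_sylow_le _ fun q hq => ?_
  have := Fact.mk hq
  obtain ⟨T⟩ := (inferInstance : Nonempty (Sylow q Q))
  refine ⟨T, ?_⟩
  by_cases hqp : q = p
  · have hT : (T : Subgroup Q) = ⊥ := by
      rw [Subgroup.eq_bot_iff_card]
      obtain ⟨n, hn⟩ := IsPGroup.iff_card.1 T.2
      have h1 : Nat.card T ∣ Nat.card Q := Subgroup.card_subgroup_dvd_card _
      refine Nat.eq_one_of_dvd_coprimes (hQ.pow_right n) h1 ?_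
      rw [← hqp, ← hn]
    rw [hT]
    exact bot_le
  · obtain ⟨S, hS⟩ := (T.2.map Q.subtype).exists_le_sylow
    have h1 := (hE q hq S).le_normalizer_inf hEP le_rfl (Sylow.inf_eq_bot_of_ne hp hq hqp P S)
      Subgroup.le_normalizer_of_normal
    rw [inf_eq_left.2 hEP] at h1
    intro t ht
    exact h1 (hS ⟨t, ht, rfl⟩)

/-- If the subgroups of `P` of order `d` (and the cyclic ones of order `4` in the exceptional case)
are `s`-permutable in `N_G(P)`, then a complement `Q` of `P` in `N_G(P)` induces on `P` an abelian
group of automorphisms of exponent dividing `p - 1`. -/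
theorem Sylow.exists_complement_normalizer {G : Type*} [Group G] [Finite G] {p d : ℕ}
    (hp : p.Prime) (P : Sylow p G) (hd1 : 1 < d) (hdP : d < Nat.card (P : Subgroup G))
    (hdvd : d ∣ Nat.card (P : Subgroup G))
    (hinv : ∀ E : Subgroup G, E ≤ P → Nat.card E = d →
      IsSPermutable (E.subgroupOf (Subgroup.normalizer ((P : Subgroup G) : Set G))))
    (hinv4 : p = 2 → ¬ (∀ x ∈ P, ∀ y ∈ P, x * y = y * x) → d = 2 →
      ∀ C : Subgroup G, C ≤ P → IsCyclic C → Nat.card C = 4 →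
        IsSPermutable (C.subgroupOf (Subgroup.normalizer ((P : Subgroup G) : Set G)))) :
    ∃ Q : Subgroup G, (P : Subgroup G) ⊔ Q = Subgroup.normalizer ((P : Subgroup G) : Set G) ∧
      (∀ a ∈ Q, a ^ (p - 1) ∈ Subgroup.centralizer ((P : Subgroup G) : Set G)) ∧
      ∀ a ∈ Q, ∀ b ∈ Q, ⁅a, b⁆ ∈ Subgroup.centralizer ((P : Subgroup G) : Set G) := by
  have := Fact.mk hp
  let X := Subgroup.normalizer ((P : Subgroup G) : Set G)
  have hPX : (P : Subgroup G) ≤ X := Subgroup.le_normalizer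
  let P' : Sylow p X := P.subtype hPX
  have hP' : (P' : Subgroup X) = (P : Subgroup G).subgroupOf X := rfl
  have hP'n : (P' : Subgroup X).Normal := by
    rw [hP']
    exact Subgroup.normal_in_normalizer
  obtain ⟨Q, hQ⟩ := Subgroup.exists_right_complement'_of_coprime P'.card_coprime_index
  have hQc : (Nat.card Q).Coprime p := by
    have h1 := hQ.card_mul_card
    rw [← (P' : Subgroup X).card_mul_index] at h1
    rw [Nat.eq_of_mul_eq_mul_left Nat.card_pos h1]
    exact ((Nat.Prime.coprime_iff_not_dvd hp).2 P'.not_dvd_index).symm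
  have hQE : ∀ E : Subgroup G, E ≤ P → IsSPermutable (E.subgroupOf X) →
      Q.map X.subtype ≤ Subgroup.normalizer (E : Set G) := by
    intro E hEP hE
    have h1 : Q ≤ Subgroup.normalizer (E.subgroupOf X : Set X) :=
      hE.le_normalizer hp hP'n (by rw [hP']; exact Subgroup.comap_mono hEP) hQc
    refine Subgroup.le_normalizer_iff.2 ?_
    rintro _ ⟨a, ha, rfl⟩ x hx
    exact (Subgroup.mem_normalizer_iff.1 (h1 ha) ⟨x, hPX (hEP hx)⟩).1 hx
  have hcent : ∀ k ∈ Q.map X.subtype, ActsTriviallyOnPrimeSections p (Q.map X.subtype) k →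
      k ∈ Subgroup.centralizer ((P : Subgroup G) : Set G) := by
    intro k hkQ hk
    refine mem_centralizer_of_forall_card_eq hp P.2 ?_ (Subgroup.map_subtype_le Q) hd1 hdP hdvd
      (fun E hEP hE => hQE E hEP (hinv E hEP hE))
      (fun h2 hnc hd C hCP hC hC4 => hQE C hCP (hinv4 h2 hnc hd C hCP hC hC4)) hkQ hk
    rwa [Subgroup.card_map_of_injective X.subtype_injective]
  refine ⟨Q.map X.subtype, ?_, fun a ha => ?_, fun a ha b hb => ?_⟩
  · have h1 : ((P' : Subgroup X) ⊔ Q).map X.subtype = X := by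
      rw [hQ.sup_eq_top, ← MonoidHom.range_eq_map, X.range_subtype]
    rwa [Subgroup.map_sup, hP', Subgroup.subgroupOf_map_subtype, inf_of_le_left hPX] at h1
  · exact hcent _ (pow_mem ha _) (.pow_sub_one hp ha)
  · exact hcent _ (by
      rw [commutatorElement_def]
      exact mul_mem (mul_mem (mul_mem ha hb) (inv_mem ha)) (inv_mem hb)) (.commutator hp ha hb)

/-- If `KP` is normal for a normal `p'`-subgroup `K`, and `N_G(P) = PQ` where `Q` induces on `P` an
abelian group of automorphisms of exponent dividing `p - 1`, then `G` is `p`-supersolvable. -/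
theorem isPSupersolvable_of_normalizer {G : Type*} [Group G] [Finite G] {p : ℕ} (hp : p.Prime)
    (hG : IsPSolvable p G) (P : Sylow p G) {K Q : Subgroup G} (hK : K.Normal)
    (hKp : (Nat.card K).Coprime p) (hKP : (K ⊔ (P : Subgroup G)).Normal)
    (hQ : (P : Subgroup G) ⊔ Q = Subgroup.normalizer ((P : Subgroup G) : Set G))
    (hpow : ∀ a ∈ Q, a ^ (p - 1) ∈ Subgroup.centralizer ((P : Subgroup G) : Set G))
    (hcomm : ∀ a ∈ Q, ∀ b ∈ Q, ⁅a, b⁆ ∈ Subgroup.centralizer ((P : Subgroup G) : Set G)) :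
    IsPSupersolvable p G := by
  have := Fact.mk hp
  -- the Frattini argument
  have htop : K ⊔ (P : Subgroup G) ⊔ Q = ⊤ := by
    have h1 := Sylow.normalizer_sup_eq_top' P (le_sup_right : (P : Subgroup G) ≤ K ⊔ P)
    rw [← h1, ← Sylow.coe_coe, ← hQ]
    apply le_antisymm
    · exact sup_le le_sup_right (le_sup_right.trans le_sup_left)
    · exact sup_le (sup_le (le_sup_right.trans le_sup_left) le_sup_right) le_sup_left
  intro M N hMN
  rcases hG M N hMN with ⟨n, hn⟩ | h
  swap
  · exact Or.inr h
  have hM := hMN.normal_bot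
  have hN := hMN.normal_top
  left
  let f := QuotientGroup.mk' M
  have hf : Function.Surjective f := QuotientGroup.mk'_surjective M
  have hcard : M.relIndex N = Nat.card (N.map f) := by
    have := Subgroup.relIndex_ker (K := N) f
    rwa [QuotientGroup.ker_mk'] at this
  have hVn : (N.map f).Normal := hN.map f hf
  have hKn : (K.map f).Normal := hK.map f hf
  have hmapcent : ∀ x ∈ Subgroup.centralizer ((P : Subgroup G) : Set G),
      f x ∈ Subgroup.centralizer (((P.mapSurjective hf : Sylow p (G ⧸ M)) : Subgroup (G ⧸ M)) :
        Set (G ⧸ M)) := by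
    intro x hx
    rw [Sylow.coe_mapSurjective, Subgroup.mem_centralizer_iff]
    rintro _ ⟨y, hy, rfl⟩
    rw [← map_mul, ← map_mul, Subgroup.mem_centralizer_iff.1 hx y hy]
  rw [hcard]
  refine card_eq_prime_of_minimal_normal (K := K.map f) (Q := Q.map f) hp (P.mapSurjective hf)
    ?_ ?_ ?_ ?_ ?_ ?_ ?_ ?_
  · intro h
    rw [Subgroup.map_eq_bot_iff, QuotientGroup.ker_mk'] at h
    exact hMN.lt.not_ge h
  · exact IsPGroup.of_card (hcard.symm.trans hn)
  · intro L hL hLN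
    have hL' : L.comap f ≤ N := by
      have := Subgroup.comap_mono (f := f) hLN
      rwa [Subgroup.comap_map_eq_self (by rw [QuotientGroup.ker_mk']; exact hMN.lt.le)] at this
    have hmap := Subgroup.map_comap_eq_self_of_surjective hf L
    rcases hMN.eq_or_eq _ (hL.comap f) (QuotientGroup.le_comap_mk' M L) hL' with h | h
    · left
      rw [← hmap, h, Subgroup.map_eq_bot_iff, QuotientGroup.ker_mk']
    · right
      rw [← hmap, h]
  · exact hKp.coprime_dvd_left (Subgroup.card_map_dvd K f)
  · rw [Sylow.coe_mapSurjective, ← Subgroup.map_sup]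
    exact hKP.map f hf
  · rw [Sylow.coe_mapSurjective, ← Subgroup.map_sup, ← Subgroup.map_sup, htop,
      Subgroup.map_top_of_surjective f hf]
  · rintro _ ⟨a, ha, rfl⟩
    rw [← map_pow]
    exact hmapcent _ (hpow a ha)
  · rintro _ ⟨a, ha, rfl⟩ _ ⟨b, hb, rfl⟩
    rw [← map_commutatorElement]
    exact hmapcent _ (hcomm a ha b hb)

theorem le_of_le_sup_of_le_frattini {G : Type*} [Group G] [Finite G] {P H T : Subgroup G}
    (hH : H ≤ (frattini P).map P.subtype) (hT : T ≤ P) (h : P ≤ H ⊔ T) : P ≤ T := by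
  rw [← Subgroup.subgroupOf_eq_top]
  apply frattini_nongenerating
  rw [eq_top_iff]
  intro x _
  have h1 : (T.subgroupOf P ⊔ frattini P).map P.subtype = T ⊔ (frattini P).map P.subtype := by
    rw [Subgroup.map_sup, Subgroup.subgroupOf_map_subtype, inf_of_le_left hT]
  have h2 : (x : G) ∈ (T.subgroupOf P ⊔ frattini P).map P.subtype := by
    rw [h1]
    exact (sup_le (hH.trans le_sup_right) le_sup_left : H ⊔ T ≤ _) (h x.2)
  obtain ⟨y, hy, hyx⟩ := h2
  rwa [← P.subtype_injective hyx]

theorem theorem5p3 {p : ℕ} (hp : p.Prime) {G : Type*} [Group G] [Finite G]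
    (hG : IsPSolvable p G) (P : Sylow p G)
    -- a subgroup `H` of `P` with `P' ≤ H ≤ Φ(P)` that is `s`-semipermutable in `G`
    (hH : ∃ H : Subgroup G,
      ⁅(P : Subgroup G), (P : Subgroup G)⁆ ≤ H ∧
      H ≤ (frattini (P : Subgroup G)).map (P : Subgroup G).subtype ∧
      IsSSemipermutable H)
    -- a subgroup `D` of `P` with `1 < |D| < |P|`
    (hD : ∃ D : Subgroup G, D ≤ (P : Subgroup G) ∧
      1 < Nat.card D ∧ Nat.card D < Nat.card (P : Subgroup G) ∧
      -- all subgroups of `P` of order `|D|` are `s`-permutable in `N_G(P)`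
      (∀ E : Subgroup G, E ≤ (P : Subgroup G) → Nat.card E = Nat.card D →
        IsSPermutable (E.subgroupOf (Subgroup.normalizer ((P : Subgroup G) : Set G)))) ∧
      -- if `P` is a nonabelian `2`-group and `|D| = 2`, also the cyclic subgroups of order `4`
      (p = 2 → ¬ (∀ x ∈ P, ∀ y ∈ P, x * y = y * x) → Nat.card D = 2 →
        ∀ C : Subgroup G, C ≤ (P : Subgroup G) → IsCyclic C → Nat.card C = 4 →
          IsSPermutable (C.subgroupOf (Subgroup.normalizer ((P : Subgroup G) : Set G))))) :
    IsPSupersolvable p G := by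
  have := Fact.mk hp
  obtain ⟨H, hPH, hHF, hHs⟩ := hH
  obtain ⟨D, hDP, hD1, hD2, hinv, hinv4⟩ := hD
  have hHP : H ≤ P := hHF.trans (Subgroup.map_subtype_le _)
  have hHN : IsPermutableNongenerator p (P : Subgroup G) H :=
    { commutator_le := hPH
      le := hHP
      nongenerating := fun T hT => le_of_le_sup_of_le_frattini hHF hT
      permute := fun q hq hqp => hHs q hq fun hdvd => hqp (by
        obtain ⟨n, hn⟩ := IsPGroup.iff_card.1 (P.2.to_le hHP)
        exact (Nat.prime_dvd_prime_iff_eq hq hp).1 (hq.dvd_of_dvd_pow (hn ▸ hdvd))) }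
  obtain ⟨K, hK, hKp, hKP⟩ := hHN.exists_normal_sup_normal hp _ rfl hG P H
  obtain ⟨Q, hQ, hpow, hcomm⟩ := P.exists_complement_normalizer hp hD1 hD2
    (Subgroup.card_dvd_of_le hDP) hinv hinv4
  exact isPSupersolvable_of_normalizer hp hG P hK hKp hKP hQ hpow hcomm
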